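/- Let $K\subset\mathbb{R}^2$ be a planar convex body, i.e. a compact convex set with nonempty interior. For $n\ge 1$ let $K_n$ be the convex hull of $n$ independent random points, each uniformly distributed in $K$. For a convex polytope $P$, let $f_i(P)$ be the number of its $i$-dimensional faces, where the faces of $P$ are the nonempty intersections of $P$ with its supporting lines, together with $P$ itself (so a point has $f_0=1,\ f_1=0$ and a segment has $f_0=2,\ f_1=1$). Then for every integer $n\ge 1$ and each $i\in\{0,1\}$, $$\mathbb{E}[f_i(K_{n+1})] > \mathbb{E}[f_i(K_n)].$$ -/

import Mathlib

open MeasureTheory ProbabilityTheory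

/-- The number `f_i(P)` of `i`-dimensional faces of a convex polytope `P ⊆ ℝ^d`. A face is a
nonempty intersection of `P` with a supporting hyperplane, or `P` itself (the zero functional in
`IsExposed`); its dimension is the dimension of its affine hull. -/
noncomputable def faceCount {d : ℕ} (i : ℕ) (P : Set (EuclideanSpace ℝ (Fin d))) : ℕ :=
  {F : Set (EuclideanSpace ℝ (Fin d)) | F.Nonempty ∧ IsExposed ℝ P F ∧
    Module.finrank ℝ (affineSpan ℝ F).direction = i}.ncard

/-- The joint law of `n` independent random points, each uniformly distributed in `K`. -/
noncomputable def uniformSample {d : ℕ} (K : Set (EuclideanSpace ℝ (Fin d))) (n : ℕ) :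
    Measure (Fin n → EuclideanSpace ℝ (Fin d)) :=
  Measure.pi fun _ => ProbabilityTheory.cond volume K

/-- `f_i(K_n)` as a function of the `n` sample points `x 0, …, x (n - 1)`, where `K_n` is their
convex hull. -/
noncomputable def hullFaceCount {d : ℕ} (i n : ℕ) (x : Fin n → EuclideanSpace ℝ (Fin d)) : ℝ :=
  (faceCount i (convexHull ℝ (Set.range x)) : ℝ)

/-- The expectation `E[f_i(K_n)]`. -/
noncomputable def expectedFaceCount {d : ℕ} (K : Set (EuclideanSpace ℝ (Fin d))) (i n : ℕ) : ℝ :=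
  ∫ x, hullFaceCount i n x ∂(uniformSample K n)

/-! Almost surely the sample is in general position. For n ≥ 3 points in general position both f_0
and f_1 of the hull equal the number of ordered pairs (j, k) such that all other points lie strictly
left of the line from x j to x k. Write n = m + 2 and let G be the mass to the left of the directed
line through two independent points. Conditioning on the pair gives E f_i = (m + 2)(m + 1) ∫ G^m
(`integrable_hullFaceCount_and_integral`). Hence the increment from n to n + 1 is (m + 2) ∫ D(1 - G)
with D(v) = (1 - v)^m (2 - (m + 3) v), the `momentDensity`. D changes sign, so positivity of this
integral needs convexity.

By the affine Blaschke-Petkantschin formula, a pair of points becomes a line y = a x + b together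
with two abscissas x₁, x₂, with weight |x₁ - x₂|. Fix the slope a. Let h(b) be the length of the
projected chord, s(b) the area of the body below the line, A the total area. The two abscissas
contribute h³/3, and the two orders of the pair turn D(1 - G) into D(s/A) + D(1 - s/A). So it
suffices that ∫ h³ (D(s/A) + D(1 - s/A)) db > 0 for each slope.

Three facts give this. First, h s D(s/A) is the derivative of s² (1 - s/A)^(m+1), so its integral
vanishes. Second, h is concave, which makes h²/s decreasing (`sq_mul_integral_le`). Third, D passes
from + to - at v = 2/(m + 3). With c the value of h²/s at that point, (h² - c s) D(s/A) ≥ 0, and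
therefore ∫ h³ D(s/A) = ∫ h (h² - c s) D(s/A) ≥ 0 (`exists_comparison`). Reflecting b to -b handles
the other term. One of the two integrals may vanish, when h² = c s throughout, as for a triangle
with its apex at the lower end; both cannot, since h² = c s = c' (A - s) would make s constant. -/

/-- `S` is the set of indices at which some linear functional is maximal over the points `x`. -/
def IsMaxIndexSet {d n : ℕ} (x : Fin n → EuclideanSpace ℝ (Fin d)) (S : Finset (Fin n)) : Prop :=
  ∃ l : StrongDual ℝ (EuclideanSpace ℝ (Fin d)), ∀ j, j ∈ S ↔ ∀ k, l (x k) ≤ l (x j)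

/-! ### Faces of a convex hull as index sets of maximizing points -/

section faces

variable {d n : ℕ} {x : Fin n → EuclideanSpace ℝ (Fin d)}

theorem le_of_mem_convexHull_range {l : StrongDual ℝ (EuclideanSpace ℝ (Fin d))} {c : ℝ}
    (hc : ∀ k, l (x k) ≤ c) {y : EuclideanSpace ℝ (Fin d)}
    (hy : y ∈ convexHull ℝ (Set.range x)) : l y ≤ c := by
  have hconv : Convex ℝ {z | l z ≤ c} := convex_halfSpace_le l.toLinearMap.isLinear c
  exact convexHull_min (by rintro _ ⟨k, rfl⟩; exact hc k) hconv hy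

/-- The value of l at a convex combination is the weighted average of its values at the points, so
it reaches the maximum only if all nonzero weights sit on maximizing indices. -/
theorem maximizers_convexHull_range {l : StrongDual ℝ (EuclideanSpace ℝ (Fin d))}
    {S : Finset (Fin n)} (hS : ∀ j, j ∈ S ↔ ∀ k, l (x k) ≤ l (x j)) :
    {z ∈ convexHull ℝ (Set.range x) | ∀ y ∈ convexHull ℝ (Set.range x), l y ≤ l z} =
      convexHull ℝ (x '' S) := by
  classical
  ext z
  constructor
  · rintro ⟨hz, hmax⟩
    have hmem : ∀ k, x k ∈ convexHull ℝ (Set.range x) :=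
      fun k => subset_convexHull _ _ ⟨k, rfl⟩
    rw [convexHull_range_eq_exists_affineCombination] at hz
    obtain ⟨s, w, hw0, hw1, rfl⟩ := hz
    rw [Finset.affineCombination_eq_linear_combination _ _ _ hw1] at hmax ⊢
    set z := ∑ i ∈ s, w i • x i with hzdef
    have hlz : ∑ i ∈ s, w i * (l z - l (x i)) = 0 := by
      simp only [mul_sub, Finset.sum_sub_distrib, ← Finset.sum_mul, hw1, one_mul]
      simp [hzdef, map_sum]
    have hzero := (Finset.sum_eq_zero_iff_of_nonneg (fun i hi =>
      mul_nonneg (hw0 i hi) (sub_nonneg.2 (hmax _ (hmem i))))).1 hlz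
    have hout : ∀ i ∈ s, w i ≠ 0 → x i ∈ x '' S := by
      intro i hi hwi
      refine ⟨i, (hS i).2 fun k => ?_, rfl⟩
      have h1 := (mul_eq_zero.1 (hzero i hi)).resolve_left hwi
      have h2 := hmax _ (hmem k)
      linarith
    have : s.centerMass w x ∈ convexHull ℝ (x '' S) := by
      rw [← Finset.centerMass_filter_ne_zero]
      refine Finset.centerMass_mem_convexHull _ (fun i hi => hw0 i (Finset.mem_filter.1 hi).1) ?_
        (fun i hi => hout i (Finset.mem_filter.1 hi).1 (Finset.mem_filter.1 hi).2)
      rw [Finset.sum_filter_ne_zero, hw1]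
      norm_num
    rwa [Finset.centerMass_eq_of_sum_1 _ _ hw1] at this
  · intro hz
    have hsub : x '' S ⊆ Set.range x := Set.image_subset_range _ _
    refine ⟨convexHull_mono hsub hz, fun y hy => ?_⟩
    have hconv : Convex ℝ {z | l y ≤ l z} := convex_halfSpace_ge l.toLinearMap.isLinear _
    refine convexHull_min ?_ hconv hz
    rintro _ ⟨j, hj, rfl⟩
    exact le_of_mem_convexHull_range ((hS j).1 hj) hy

/-- Recovers S from its face, which makes the passage from index sets to faces injective. -/
theorem mem_of_mem_convexHull_image {l : StrongDual ℝ (EuclideanSpace ℝ (Fin d))}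
    {S : Finset (Fin n)} (hS : ∀ j, j ∈ S ↔ ∀ k, l (x k) ≤ l (x j)) {j : Fin n}
    (hj : x j ∈ convexHull ℝ (x '' S)) : j ∈ S := by
  rw [← maximizers_convexHull_range hS] at hj
  exact (hS j).2 fun k => hj.2 _ (subset_convexHull _ _ ⟨k, rfl⟩)

theorem IsMaxIndexSet.nonempty [NeZero n] {S : Finset (Fin n)} (hS : IsMaxIndexSet x S) :
    S.Nonempty := by
  obtain ⟨l, hl⟩ := hS
  obtain ⟨j, -, hj⟩ := Finset.exists_max_image Finset.univ (fun k => l (x k)) ⟨0, by simp⟩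
  exact ⟨j, (hl j).2 fun k => hj k (Finset.mem_univ k)⟩

/-- Faces of dimension `i` correspond to index sets of `i + 1` maximizing points, provided
dimensions of the spans are as expected. -/
theorem faceCount_convexHull_range [NeZero n] (i : ℕ)
    (hdim : ∀ S : Finset (Fin n), S.Nonempty →
      (Module.finrank ℝ (vectorSpan ℝ (x '' S)) = i ↔ S.card = i + 1)) :
    faceCount i (convexHull ℝ (Set.range x)) =
      {S : Finset (Fin n) | IsMaxIndexSet x S ∧ S.card = i + 1}.ncard := by
  classical
  have himage : {F : Set (EuclideanSpace ℝ (Fin d)) | F.Nonempty ∧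
      IsExposed ℝ (convexHull ℝ (Set.range x)) F ∧
      Module.finrank ℝ (affineSpan ℝ F).direction = i} =
      (fun S : Finset (Fin n) => convexHull ℝ (x '' S)) ''
        {S : Finset (Fin n) | IsMaxIndexSet x S ∧ S.card = i + 1} := by
    ext F
    constructor
    · rintro ⟨hne, hexp, hF⟩
      obtain ⟨l, rfl⟩ := hexp hne
      set S : Finset (Fin n) := Finset.univ.filter fun j => ∀ k, l (x k) ≤ l (x j)
      have hS : ∀ j, j ∈ S ↔ ∀ k, l (x k) ≤ l (x j) := fun j => by simp [S]
      rw [maximizers_convexHull_range hS] at hF ⊢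
      have hmax : IsMaxIndexSet x S := ⟨l, hS⟩
      rw [affineSpan_convexHull, direction_affineSpan] at hF
      exact ⟨S, ⟨hmax, (hdim S hmax.nonempty).1 hF⟩, rfl⟩
    · rintro ⟨S, ⟨hmax, hcard⟩, rfl⟩
      have hne := hmax.nonempty
      refine ⟨(hne.to_set.image x).convexHull, fun _ => ?_, ?_⟩
      · obtain ⟨l, hl⟩ := hmax
        exact ⟨l, (maximizers_convexHull_range hl).symm⟩
      · rw [affineSpan_convexHull, direction_affineSpan]
        exact (hdim S hne).2 hcard
  rw [faceCount, himage]
  refine Set.InjOn.ncard_image ?_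
  rintro S ⟨⟨l, hl⟩, -⟩ T ⟨⟨l', hl'⟩, -⟩ hST
  simp only at hST
  ext j
  constructor
  · intro hj
    exact mem_of_mem_convexHull_image hl' (hST ▸ subset_convexHull _ _ ⟨j, hj, rfl⟩)
  · intro hj
    exact mem_of_mem_convexHull_image hl (hST ▸ subset_convexHull _ _ ⟨j, hj, rfl⟩)

end faces

/-! ### Vertices and edges of planar hulls via orientations -/

/-- Twice the signed area of the triangle `p q r`. -/
def orient (p q r : EuclideanSpace ℝ (Fin 2)) : ℝ :=
  (q 0 - p 0) * (r 1 - p 1) - (q 1 - p 1) * (r 0 - p 0)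

/-- All points other than `x j` and `x k` lie strictly to the left of the line from `x j` to
`x k`. -/
def IsLeftEdge {n : ℕ} (x : Fin n → EuclideanSpace ℝ (Fin 2)) (e : Fin n × Fin n) : Prop :=
  e.1 ≠ e.2 ∧ ∀ m, m ≠ e.1 → m ≠ e.2 → 0 < orient (x e.1) (x e.2) (x m)

/-- Distinct points, no three of which are collinear. -/
def InGeneralPosition {n : ℕ} (x : Fin n → EuclideanSpace ℝ (Fin 2)) : Prop :=
  Function.Injective x ∧
    ∀ i j k, i ≠ j → i ≠ k → j ≠ k → orient (x i) (x j) (x k) ≠ 0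

section planar

theorem euclidean_dual_apply (l : StrongDual ℝ (EuclideanSpace ℝ (Fin 2)))
    (v : EuclideanSpace ℝ (Fin 2)) :
    l v = l (EuclideanSpace.single 0 1) * v 0 + l (EuclideanSpace.single 1 1) * v 1 := by
  have hv : v = v 0 • EuclideanSpace.single 0 (1 : ℝ) + v 1 • EuclideanSpace.single 1 (1 : ℝ) := by
    ext i
    fin_cases i <;> simp
  conv_lhs => rw [hv]
  simp [mul_comm]

/-- The functional with coefficients `a` and `b`. -/
noncomputable def coordFunctional (a b : ℝ) : StrongDual ℝ (EuclideanSpace ℝ (Fin 2)) :=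
  a • EuclideanSpace.proj (0 : Fin 2) + b • EuclideanSpace.proj (1 : Fin 2)

@[simp]
theorem coordFunctional_apply (a b : ℝ) (v : EuclideanSpace ℝ (Fin 2)) :
    coordFunctional a b v = a * v 0 + b * v 1 := by
  simp [coordFunctional]

variable {n : ℕ} {x : Fin n → EuclideanSpace ℝ (Fin 2)}

theorem vectorSpan_pair_finrank {p q : EuclideanSpace ℝ (Fin 2)} (h : p ≠ q) :
    Module.finrank ℝ (vectorSpan ℝ {p, q}) = 1 := by
  rw [vectorSpan_pair, finrank_span_singleton]
  simpa [sub_eq_zero] using h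

theorem two_le_finrank_vectorSpan {s : Set (EuclideanSpace ℝ (Fin 2))}
    {p q r : EuclideanSpace ℝ (Fin 2)} (hp : p ∈ s) (hq : q ∈ s) (hr : r ∈ s)
    (h : orient p q r ≠ 0) : 2 ≤ Module.finrank ℝ (vectorSpan ℝ s) := by
  have hli : LinearIndependent ℝ ![q - p, r - p] := by
    rw [LinearIndependent.pair_iff]
    intro a b hab
    have h0 := congrArg (fun v => v 0) hab
    have h1 := congrArg (fun v => v 1) hab
    simp at h0 h1
    unfold orient at h
    constructor
    · refine (mul_eq_zero.1 (?_ : a * _ = 0)).resolve_right h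
      linear_combination (r 1 - p 1) * h0 - (r 0 - p 0) * h1
    · refine (mul_eq_zero.1 (?_ : b * _ = 0)).resolve_right h
      linear_combination (q 0 - p 0) * h1 - (q 1 - p 1) * h0
  have hcard := finrank_span_eq_card hli
  rw [Fintype.card_fin] at hcard
  refine hcard.symm.le.trans (Submodule.finrank_mono (Submodule.span_le.2 ?_))
  rintro _ ⟨i, rfl⟩
  fin_cases i
  · exact vsub_mem_vectorSpan ℝ hq hp
  · exact vsub_mem_vectorSpan ℝ hr hp

theorem InGeneralPosition.finrank_eq_iff (hx : InGeneralPosition x) {i : ℕ} (hi : i = 0 ∨ i = 1)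
    (S : Finset (Fin n)) (hS : S.Nonempty) :
    Module.finrank ℝ (vectorSpan ℝ (x '' S)) = i ↔ S.card = i + 1 := by
  classical
  have hpos := hS.card_pos
  by_cases h1 : S.card = 1
  · obtain ⟨a, rfl⟩ := Finset.card_eq_one.1 h1
    have himg : x '' ({a} : Finset (Fin n)) = {x a} := by simp
    rw [himg, vectorSpan_singleton, finrank_bot, h1]
    omega
  by_cases h2 : S.card = 2
  · obtain ⟨a, b, hab, rfl⟩ := Finset.card_eq_two.1 h2
    have himg : x '' ({a, b} : Finset (Fin n)) = {x a, x b} := by simp [Set.image_pair]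
    rw [himg, vectorSpan_pair_finrank (hx.1.ne hab), h2]
    omega
  · obtain ⟨a, b, c, ha, hb, hc, hab, hac, hbc⟩ :=
      Finset.two_lt_card_iff.1 (show 2 < S.card by omega)
    have := two_le_finrank_vectorSpan (s := x '' S) ⟨a, ha, rfl⟩ ⟨b, hb, rfl⟩ ⟨c, hc, rfl⟩
      (hx.2 a b c hab hac hbc)
    omega

/-- The outward normal (b, -a) of the edge with direction (a, b) ties at j and k. Subtracting ε (a,
b) breaks the tie in favour of j, and the finitely many strict inequalities at the other points
survive for small ε > 0. -/
theorem isMaxIndexSet_singleton_of_isLeftEdge (hx : Function.Injective x) {j k : Fin n}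
    (h : IsLeftEdge x (j, k)) : IsMaxIndexSet x {j} := by
  obtain ⟨hjk, h⟩ := h
  simp only at hjk h
  have hev : ∀ m, m ≠ j → m ≠ k → ∀ᶠ ε in nhdsWithin (0 : ℝ) (Set.Ioi 0),
      0 < orient (x j) (x k) (x m) + ε * ((x k 0 - x j 0) * (x m 0 - x j 0) +
        (x k 1 - x j 1) * (x m 1 - x j 1)) := by
    intro m hmj hmk
    refine (ContinuousAt.eventually_lt (f := fun _ => (0 : ℝ)) (by fun_prop) (by fun_prop) ?_).filter_mono
      nhdsWithin_le_nhds
    simpa using h m hmj hmk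
  have hev' : ∀ᶠ ε in nhdsWithin (0 : ℝ) (Set.Ioi 0), ∀ m, m ≠ j → m ≠ k →
      0 < orient (x j) (x k) (x m) + ε * ((x k 0 - x j 0) * (x m 0 - x j 0) +
        (x k 1 - x j 1) * (x m 1 - x j 1)) := by
    simpa only [Filter.eventually_all] using hev
  obtain ⟨ε, hε, hεpos⟩ := (hev'.and self_mem_nhdsWithin).exists
  have hεpos : 0 < ε := hεpos
  set a := x k 0 - x j 0 with ha
  set b := x k 1 - x j 1 with hb
  have hlt : ∀ m, m ≠ j → coordFunctional (b - ε * a) (-a - ε * b) (x m) <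
      coordFunctional (b - ε * a) (-a - ε * b) (x j) := by
    intro m hmj
    simp only [coordFunctional_apply]
    by_cases hmk : m = k
    · subst hmk
      have hab : 0 < a ^ 2 + b ^ 2 := by
        by_contra hneg
        have ha0 : a = 0 := by nlinarith [sq_nonneg a, sq_nonneg b]
        have hb0 : b = 0 := by nlinarith [sq_nonneg a, sq_nonneg b]
        refine hmj (hx ?_)
        ext i
        fin_cases i
        · simpa [ha, sub_eq_zero] using ha0
        · simpa [hb, sub_eq_zero] using hb0
      have := mul_pos hεpos hab
      have h1 : x m 0 = x j 0 + a := by rw [ha]; ring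
      have h2 : x m 1 = x j 1 + b := by rw [hb]; ring
      rw [h1, h2]
      nlinarith
    · have := hε m hmj hmk
      unfold orient at this
      rw [← ha, ← hb] at this
      nlinarith
  refine ⟨coordFunctional (b - ε * a) (-a - ε * b), fun i => ?_⟩
  rw [Finset.mem_singleton]
  constructor
  · rintro rfl m
    by_cases hm : m = i
    · rw [hm]
    · exact (hlt m hm).le
  · intro hmax
    by_contra hij
    exact absurd (hmax j) (not_le.2 (hlt i hij))

/-- Seen from x j, all other points lie in the open half-plane u > 0. The next vertex is the one of
greatest slope w / u, since orientation is, up to a positive factor, the determinant in the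
coordinates (u, w). -/
theorem InGeneralPosition.exists_isLeftEdge (hx : InGeneralPosition x) {j : Fin n} (hn : 2 ≤ n)
    (h : IsMaxIndexSet x {j}) : ∃ k, IsLeftEdge x (j, k) := by
  classical
  obtain ⟨l, hl⟩ := h
  simp only [Finset.mem_singleton] at hl
  have hlt : ∀ k, k ≠ j → 0 < l (x j) - l (x k) := by
    intro k hk
    have h1 := (hl j).1 rfl
    have h2 := mt (hl k).2 hk
    push Not at h2
    obtain ⟨i, hi⟩ := h2
    linarith [h1 i]
  set a := l (EuclideanSpace.single 0 1)
  set b := l (EuclideanSpace.single 1 1)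
  have hlv : ∀ v, l v = a * v 0 + b * v 1 := euclidean_dual_apply l
  set u : Fin n → ℝ := fun k => l (x j) - l (x k) with hu
  set w : Fin n → ℝ := fun k => a * (x k 1 - x j 1) - b * (x k 0 - x j 0) with hw
  obtain ⟨k₀, hk₀⟩ : ∃ k₀ : Fin n, k₀ ≠ j := by
    have : Nontrivial (Fin n) := Fin.nontrivial_iff_two_le.2 hn
    exact exists_ne j
  obtain ⟨k, hk, hmax⟩ := Finset.exists_max_image (Finset.univ.erase j) (fun k => w k / u k)
    ⟨k₀, by simpa using hk₀⟩
  have hkj : k ≠ j := Finset.ne_of_mem_erase hk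
  refine ⟨k, hkj.symm, fun m hmj hmk => ?_⟩
  simp only at hmj hmk ⊢
  have h1 := hmax m (Finset.mem_erase.2 ⟨hmj, Finset.mem_univ m⟩)
  rw [div_le_div_iff₀ (hlt m hmj) (hlt k hkj)] at h1
  have hid : (a ^ 2 + b ^ 2) * orient (x j) (x k) (x m) = w k * u m - w m * u k := by
    simp only [hu, hw, hlv, orient]
    ring
  have hab : 0 < a ^ 2 + b ^ 2 := by
    have := hlt k hkj
    rw [hlv, hlv] at this
    by_contra hneg
    have ha0 : a = 0 := by nlinarith [sq_nonneg a, sq_nonneg b]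
    have hb0 : b = 0 := by nlinarith [sq_nonneg a, sq_nonneg b]
    simp [ha0, hb0] at this
  have hne := hx.2 j k m hkj.symm hmj.symm hmk.symm
  refine lt_of_le_of_ne ?_ hne.symm
  by_contra hneg
  nlinarith

theorem IsLeftEdge.isMaxIndexSet_pair {j k : Fin n} (h : IsLeftEdge x (j, k)) :
    IsMaxIndexSet x {j, k} := by
  obtain ⟨hjk, h⟩ := h
  simp only at hjk h
  set a := x k 0 - x j 0 with ha
  set b := x k 1 - x j 1 with hb
  have heq : coordFunctional b (-a) (x k) = coordFunctional b (-a) (x j) := by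
    simp only [coordFunctional_apply, ha, hb]
    ring
  have hlt : ∀ m, m ≠ j → m ≠ k →
      coordFunctional b (-a) (x m) < coordFunctional b (-a) (x j) := by
    intro m hmj hmk
    have := h m hmj hmk
    unfold orient at this
    rw [← ha, ← hb] at this
    simp only [coordFunctional_apply]
    linarith
  have hle : ∀ m, coordFunctional b (-a) (x m) ≤ coordFunctional b (-a) (x j) := by
    intro m
    by_cases hmj : m = j
    · rw [hmj]
    by_cases hmk : m = k
    · rw [hmk, heq]
    exact (hlt m hmj hmk).le
  refine ⟨coordFunctional b (-a), fun i => ?_⟩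
  rw [Finset.mem_insert, Finset.mem_singleton]
  constructor
  · rintro (rfl | rfl)
    · exact hle
    · rwa [heq]
  · intro hmax
    by_contra hi
    push Not at hi
    exact absurd (hmax j) (not_le.2 (hlt i hi.1 hi.2))

/-- A functional that ties at j and k differs from its common value there by a fixed multiple of
`orient (x j) (x k)`. So all other points lie on one side, and the sign of that multiple decides
which direction of the edge has them on its left. -/
theorem InGeneralPosition.isLeftEdge_or (hx : InGeneralPosition x) {j k : Fin n}
    (hjk : j ≠ k) (h : IsMaxIndexSet x {j, k}) : IsLeftEdge x (j, k) ∨ IsLeftEdge x (k, j) := by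
  classical
  obtain ⟨l, hl⟩ := h
  simp only [Finset.mem_insert, Finset.mem_singleton] at hl
  set a := l (EuclideanSpace.single 0 1)
  set b := l (EuclideanSpace.single 1 1)
  have hlv : ∀ v, l v = a * v 0 + b * v 1 := euclidean_dual_apply l
  have hj := (hl j).1 (Or.inl rfl)
  have hk := (hl k).1 (Or.inr rfl)
  have heq : l (x k) = l (x j) := le_antisymm (hj k) (hk j)
  have hlt : ∀ m, m ≠ j → m ≠ k → l (x m) < l (x j) := by
    intro m hmj hmk
    refine lt_of_le_of_ne (hj m) fun hne => ?_
    have := (hl m).2 fun i => hne ▸ hj i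
    tauto
  set c := (x k 0 - x j 0) * b - (x k 1 - x j 1) * a with hc
  have hid : ∀ m, ((x k 0 - x j 0) ^ 2 + (x k 1 - x j 1) ^ 2) * (l (x m) - l (x j)) =
      c * orient (x j) (x k) (x m) := by
    intro m
    rw [hlv, hlv] at heq
    rw [hlv, hlv, hc, orient]
    linear_combination ((x k 0 - x j 0) * (x m 0 - x j 0) +
      (x k 1 - x j 1) * (x m 1 - x j 1)) * heq
  have hd : 0 < (x k 0 - x j 0) ^ 2 + (x k 1 - x j 1) ^ 2 := by
    by_contra hneg
    have ha0 : x k 0 - x j 0 = 0 := by nlinarith [sq_nonneg (x k 0 - x j 0), sq_nonneg (x k 1 - x j 1)]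
    have hb0 : x k 1 - x j 1 = 0 := by nlinarith [sq_nonneg (x k 0 - x j 0), sq_nonneg (x k 1 - x j 1)]
    refine hjk (hx.1 ?_)
    ext i
    fin_cases i
    · exact (sub_eq_zero.1 ha0).symm
    · exact (sub_eq_zero.1 hb0).symm
  have hneg : ∀ m, m ≠ j → m ≠ k → c * orient (x j) (x k) (x m) < 0 := by
    intro m hmj hmk
    rw [← hid]
    exact mul_neg_of_pos_of_neg hd (sub_neg.2 (hlt m hmj hmk))
  rcases lt_or_ge c 0 with hc0 | hc0
  · left
    refine ⟨hjk, fun m hmj hmk => ?_⟩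
    have := hneg m hmj hmk
    simp only
    by_contra hcon
    nlinarith
  · right
    refine ⟨hjk.symm, fun m hmk hmj => ?_⟩
    have := hneg m hmj hmk
    have hsymm : orient (x k) (x j) (x m) = -orient (x j) (x k) (x m) := by
      simp only [orient]; ring
    simp only [hsymm]
    by_contra hcon
    nlinarith

theorem orient_swap_left (p q r : EuclideanSpace ℝ (Fin 2)) : orient q p r = -orient p q r := by
  simp only [orient]; ring

theorem orient_swap_right (p q r : EuclideanSpace ℝ (Fin 2)) : orient p r q = -orient p q r := by
  simp only [orient]; ring

theorem IsLeftEdge.right_unique {j k k' : Fin n} (h : IsLeftEdge x (j, k))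
    (h' : IsLeftEdge x (j, k')) : k = k' := by
  by_contra hne
  have h1 := h.2 k' h'.1.symm (Ne.symm hne)
  have h2 := h'.2 k h.1.symm hne
  rw [orient_swap_right] at h2
  simp only at h1 h2
  linarith

theorem IsLeftEdge.not_swap {j k : Fin n} (hn : 3 ≤ n) (h : IsLeftEdge x (j, k)) :
    ¬ IsLeftEdge x (k, j) := by
  intro h'
  obtain ⟨m, hm⟩ : ∃ m, m ∉ ({j, k} : Finset (Fin n)) := by
    by_contra hcon
    push Not at hcon
    have := Finset.card_le_card (s := Finset.univ) (t := ({j, k} : Finset (Fin n)))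
      fun m _ => hcon m
    have h2 := Finset.card_le_two (a := j) (b := k)
    rw [Finset.card_univ, Fintype.card_fin] at this
    omega
  simp only [Finset.mem_insert, Finset.mem_singleton, not_or] at hm
  have h1 := h.2 m hm.1 hm.2
  have h2 := h'.2 m hm.2 hm.1
  rw [orient_swap_left] at h2
  simp only at h1 h2
  linarith

/-- Each vertex is matched with the unique left edge that leaves it. -/
theorem InGeneralPosition.ncard_singletons (hx : InGeneralPosition x) (hn : 2 ≤ n) :
    {S : Finset (Fin n) | IsMaxIndexSet x S ∧ S.card = 0 + 1}.ncard =
      {e | IsLeftEdge x e}.ncard := by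
  refine (Set.ncard_congr (fun e _ => {e.1}) ?_ ?_ ?_).symm
  · rintro ⟨j, k⟩ h
    exact ⟨isMaxIndexSet_singleton_of_isLeftEdge hx.1 h, by simp⟩
  · rintro ⟨j, k⟩ ⟨j', k'⟩ h h' heq
    obtain rfl : j = j' := by simpa using heq
    rw [IsLeftEdge.right_unique h h']
  · rintro S ⟨hS, hcard⟩
    obtain ⟨j, rfl⟩ := Finset.card_eq_one.1 hcard
    obtain ⟨k, hk⟩ := hx.exists_isLeftEdge hn hS
    exact ⟨(j, k), hk, rfl⟩

/-- Three points are needed: with two, both directions of the segment are left edges vacuously, and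
the edge would be counted twice. -/
theorem InGeneralPosition.ncard_pairs (hx : InGeneralPosition x) (hn : 3 ≤ n) :
    {S : Finset (Fin n) | IsMaxIndexSet x S ∧ S.card = 1 + 1}.ncard =
      {e | IsLeftEdge x e}.ncard := by
  classical
  refine (Set.ncard_congr (fun e _ => {e.1, e.2}) ?_ ?_ ?_).symm
  · rintro ⟨j, k⟩ h
    exact ⟨IsLeftEdge.isMaxIndexSet_pair h, Finset.card_pair h.1⟩
  · rintro ⟨j, k⟩ ⟨j', k'⟩ h h' heq
    simp only at heq
    have hj : j ∈ ({j', k'} : Finset (Fin n)) := heq ▸ Finset.mem_insert_self _ _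
    have hk : k ∈ ({j', k'} : Finset (Fin n)) := heq ▸ by simp
    simp only [Finset.mem_insert, Finset.mem_singleton] at hj hk
    have hjk : j ≠ k := h.1
    rcases hj with rfl | rfl <;> rcases hk with rfl | rfl
    · exact absurd rfl hjk
    · rfl
    · exact absurd h' (IsLeftEdge.not_swap hn h)
    · exact absurd rfl hjk
  · rintro S ⟨hS, hcard⟩
    obtain ⟨j, k, hjk, rfl⟩ := Finset.card_eq_two.1 hcard
    rcases hx.isLeftEdge_or hjk hS with h | h
    · exact ⟨(j, k), h, rfl⟩
    · exact ⟨(k, j), h, Finset.pair_comm _ _⟩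

/-- The numbers of vertices and of edges both equal the number of positively oriented edges. -/
theorem InGeneralPosition.hullFaceCount_eq (hx : InGeneralPosition x) (hn : 3 ≤ n) {i : ℕ}
    (hi : i = 0 ∨ i = 1) : hullFaceCount i n x = ({e | IsLeftEdge x e}.ncard : ℝ) := by
  have : NeZero n := ⟨by omega⟩
  rw [hullFaceCount, faceCount_convexHull_range i (hx.finrank_eq_iff hi)]
  rcases hi with rfl | rfl
  · rw [hx.ncard_singletons (by omega)]
  · rw [hx.ncard_pairs hn]

theorem InGeneralPosition.hullFaceCount_one {x : Fin 1 → EuclideanSpace ℝ (Fin 2)}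
    (hx : InGeneralPosition x) {i : ℕ} (hi : i = 0 ∨ i = 1) :
    hullFaceCount i 1 x = if i = 0 then 1 else 0 := by
  rw [hullFaceCount, faceCount_convexHull_range i (hx.finrank_eq_iff hi)]
  rcases hi with rfl | rfl
  · have : {S : Finset (Fin 1) | IsMaxIndexSet x S ∧ S.card = 0 + 1} = {{0}} := by
      ext S
      constructor
      · rintro ⟨-, h⟩
        obtain ⟨j, rfl⟩ := Finset.card_eq_one.1 h
        rw [Subsingleton.elim j 0]; rfl
      · rintro rfl
        exact ⟨⟨0, fun j => by simp [Subsingleton.elim j 0]⟩, by simp⟩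
    simp [this]
  · have : {S : Finset (Fin 1) | IsMaxIndexSet x S ∧ S.card = 1 + 1} = ∅ := by
      ext S
      simp only [Set.mem_ofPred_eq, Set.mem_empty_iff_false, iff_false, not_and]
      intro _ h
      have := Finset.card_le_univ S
      simp at this
      omega
    simp [this]

theorem InGeneralPosition.hullFaceCount_two {x : Fin 2 → EuclideanSpace ℝ (Fin 2)}
    (hx : InGeneralPosition x) {i : ℕ} (hi : i = 0 ∨ i = 1) :
    hullFaceCount i 2 x = if i = 0 then 2 else 1 := by
  classical
  rw [hullFaceCount, faceCount_convexHull_range i (hx.finrank_eq_iff hi)]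
  rcases hi with rfl | rfl
  · rw [hx.ncard_singletons le_rfl]
    have : {e | IsLeftEdge x e} = {((0 : Fin 2), (1 : Fin 2)), (1, 0)} := by
      ext ⟨j, k⟩
      fin_cases j <;> fin_cases k <;> simp [IsLeftEdge]
    rw [this, Set.ncard_pair (by simp)]
    simp
  · have : {S : Finset (Fin 2) | IsMaxIndexSet x S ∧ S.card = 1 + 1} = {{0, 1}} := by
      ext S
      constructor
      · rintro ⟨-, h⟩
        exact (Finset.card_eq_iff_eq_univ S).1 (by simpa using h)
      · rintro rfl
        refine ⟨⟨0, fun j => ?_⟩, by simp⟩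
        fin_cases j <;> simp
    simp [this]

end planar

/-! ### Random points: general position and expected counts -/

section sampling

theorem ae_orient_ne_zero {p q : EuclideanSpace ℝ (Fin 2)} (h : p ≠ q) :
    ∀ᵐ r ∂(volume : Measure (EuclideanSpace ℝ (Fin 2))), orient p q r ≠ 0 := by
  set L := coordFunctional (-(q 1 - p 1)) (q 0 - p 0) with hL
  set A : AffineSubspace ℝ (EuclideanSpace ℝ (Fin 2)) := AffineSubspace.mk' p L.ker with hA
  have hmem : ∀ r, r ∈ A ↔ orient p q r = 0 := by
    intro r
    rw [hA, AffineSubspace.mem_mk', LinearMap.mem_ker]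
    refine Eq.congr_left ?_
    change coordFunctional _ _ _ = _
    simp [orient]
    ring
  have htop : A ≠ ⊤ := by
    intro htop
    have h0 := (hmem (p + EuclideanSpace.single 0 1)).1 (htop ▸ AffineSubspace.mem_top _ _ _)
    have h1 := (hmem (p + EuclideanSpace.single 1 1)).1 (htop ▸ AffineSubspace.mem_top _ _ _)
    simp [orient] at h0 h1
    refine h ?_
    ext i
    fin_cases i
    · simp; linarith
    · simp; linarith
  have := Measure.addHaar_affineSubspace volume A htop
  rw [ae_iff]
  convert this using 2
  ext r
  simp [hmem]

theorem measurable_orient {α : Type*} [MeasurableSpace α] {f g h : α → EuclideanSpace ℝ (Fin 2)}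
    (hf : Measurable f) (hg : Measurable g) (hh : Measurable h) :
    Measurable fun a => orient (f a) (g a) (h a) := by
  unfold orient
  fun_prop

variable {E : Type*} [MeasurableSpace E] {μ : Measure E} [IsProbabilityMeasure μ]

theorem pi_apply_insertNth {n : ℕ} (j : Fin (n + 1)) {s : Set (Fin (n + 1) → E)}
    (hs : MeasurableSet s) : Measure.pi (fun _ => μ) s =
      ∫⁻ p, Measure.pi (fun _ : Fin n => μ) {y | (j.insertNth p y : Fin (n + 1) → E) ∈ s} ∂μ := by
  have h := (measurePreserving_piFinSuccAbove (fun _ : Fin (n + 1) => μ) j).symm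
  rw [← h.measure_preimage hs.nullMeasurableSet, Measure.prod_apply (h.measurable hs)]
  rfl

/-- Fubini in the order that resamples only coordinate j while the other points stay frozen. -/
theorem ae_pi_of_forall_insertNth {n : ℕ} (j : Fin (n + 1)) {P : (Fin (n + 1) → E) → Prop}
    (hP : MeasurableSet {x | P x})
    (h : ∀ y : Fin n → E, ∀ᵐ p ∂μ, P (j.insertNth p y)) :
    ∀ᵐ x ∂Measure.pi (fun _ => μ), P x := by
  have he := (measurePreserving_piFinSuccAbove (fun _ : Fin (n + 1) => μ) j).symm
  have hm : MeasurableSet {z : E × (Fin n → E) | P (j.insertNth z.1 z.2)} := he.measurable hP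
  rw [← he.map_eq, ae_map_iff he.aemeasurable hP]
  have h2 : ∀ᵐ p ∂μ, ∀ᵐ y ∂Measure.pi (fun _ : Fin n => μ), P (j.insertNth p y) :=
    (Measure.ae_ae_comm hm).2 (Filter.Eventually.of_forall h)
  exact (Measure.ae_prod_iff_ae_ae hm).2 h2

end sampling

section planarSampling

variable {μ : Measure (EuclideanSpace ℝ (Fin 2))} [IsProbabilityMeasure μ]

theorem ae_inGeneralPosition (hμ : μ ≪ volume) (n : ℕ) :
    ∀ᵐ x ∂Measure.pi (fun _ : Fin n => μ), InGeneralPosition x := by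
  rcases n with _ | n
  · exact Filter.Eventually.of_forall fun x => ⟨fun i => i.elim0, fun i => i.elim0⟩
  have hinj : ∀ j k : Fin (n + 1), j ≠ k →
      ∀ᵐ x ∂Measure.pi (fun _ : Fin (n + 1) => μ), x j ≠ x k := by
    intro j k hjk
    obtain ⟨k, rfl⟩ := Fin.exists_succAbove_eq hjk.symm
    refine ae_pi_of_forall_insertNth j
      (measurableSet_eq_fun (by fun_prop) (by fun_prop)).compl fun y => ?_
    simp only [Fin.insertNth_apply_same, Fin.insertNth_apply_succAbove]
    exact hμ.ae_le (Measure.ae_ne volume (y k))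
  -- The alternative `x i = x j` lets the claim hold for every frozen choice of the other points,
  -- including degenerate ones; `hinj` removes it afterwards.
  have hcol : ∀ i j k : Fin (n + 1), i ≠ j → i ≠ k → j ≠ k →
      ∀ᵐ x ∂Measure.pi (fun _ : Fin (n + 1) => μ),
        x i = x j ∨ orient (x i) (x j) (x k) ≠ 0 := by
    intro i j k hij hik hjk
    obtain ⟨i, rfl⟩ := Fin.exists_succAbove_eq hik
    obtain ⟨j, rfl⟩ := Fin.exists_succAbove_eq hjk
    refine ae_pi_of_forall_insertNth k ?_ fun y => ?_
    · exact (measurableSet_eq_fun (by fun_prop) (by fun_prop)).union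
        (measurableSet_eq_fun (measurable_orient (by fun_prop) (by fun_prop) (by fun_prop))
          measurable_const).compl
    simp only [Fin.insertNth_apply_same, Fin.insertNth_apply_succAbove]
    by_cases h : y i = y j
    · simp [h]
    · filter_upwards [hμ.ae_le (ae_orient_ne_zero h)] with r hr using Or.inr hr
  have h1 : ∀ᵐ x ∂Measure.pi (fun _ : Fin (n + 1) => μ), ∀ j k : Fin (n + 1), j ≠ k →
      x j ≠ x k := by
    simpa only [ae_all_iff] using hinj
  have h2 : ∀ᵐ x ∂Measure.pi (fun _ : Fin (n + 1) => μ), ∀ i j k : Fin (n + 1),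
      i ≠ j → i ≠ k → j ≠ k → x i = x j ∨ orient (x i) (x j) (x k) ≠ 0 := by
    simpa only [ae_all_iff] using hcol
  filter_upwards [h1, h2] with x hx1 hx2
  refine ⟨fun j k hjk => ?_, fun i j k hij hik hjk =>
    (hx2 i j k hij hik hjk).resolve_left (hx1 i j hij)⟩
  by_contra hne
  exact hx1 j k hne hjk

theorem measurableSet_isLeftEdge {n : ℕ} (e : Fin n × Fin n) :
    MeasurableSet {x : Fin n → EuclideanSpace ℝ (Fin 2) | IsLeftEdge x e} := by
  have : {x : Fin n → EuclideanSpace ℝ (Fin 2) | IsLeftEdge x e} =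
      {_x | e.1 ≠ e.2} ∩ ⋂ m, ⋂ (_ : m ≠ e.1), ⋂ (_ : m ≠ e.2),
        {x | 0 < orient (x e.1) (x e.2) (x m)} := by
    ext x
    simp [IsLeftEdge]
  rw [this]
  refine (MeasurableSet.const _).inter (MeasurableSet.iInter fun m => MeasurableSet.iInter fun _ =>
    MeasurableSet.iInter fun _ => measurableSet_lt measurable_const ?_)
  exact measurable_orient (measurable_pi_apply _) (measurable_pi_apply _) (measurable_pi_apply _)

/-- The mass to the left of the directed line from `z.1` to `z.2`. -/
noncomputable def leftMass (μ : Measure (EuclideanSpace ℝ (Fin 2)))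
    (z : EuclideanSpace ℝ (Fin 2) × EuclideanSpace ℝ (Fin 2)) : ℝ :=
  μ.real {r | 0 < orient z.1 z.2 r}

theorem measurable_leftMass_ennreal : Measurable
    fun z : EuclideanSpace ℝ (Fin 2) × EuclideanSpace ℝ (Fin 2) =>
      μ {r | 0 < orient z.1 z.2 r} := by
  have hm : MeasurableSet {w : (EuclideanSpace ℝ (Fin 2) × EuclideanSpace ℝ (Fin 2)) ×
      EuclideanSpace ℝ (Fin 2) | 0 < orient w.1.1 w.1.2 w.2} :=
    measurableSet_lt measurable_const (measurable_orient (by fun_prop) (by fun_prop) (by fun_prop))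
  exact measurable_measure_prodMk_left hm

theorem measurable_leftMass : Measurable (leftMass μ) :=
  measurable_leftMass_ennreal.ennreal_toReal

theorem leftMass_nonneg {ν : Measure (EuclideanSpace ℝ (Fin 2))}
    (z : EuclideanSpace ℝ (Fin 2) × EuclideanSpace ℝ (Fin 2)) : 0 ≤ leftMass ν z :=
  measureReal_nonneg

theorem leftMass_le_one (z : EuclideanSpace ℝ (Fin 2) × EuclideanSpace ℝ (Fin 2)) :
    leftMass μ z ≤ 1 := measureReal_le_one

/-- Given the two endpoints, the other m points are independent and each falls to the left with
probability `leftMass`. -/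
theorem measureReal_isLeftEdge {m : ℕ} {e : Fin (m + 2) × Fin (m + 2)} (he : e.1 ≠ e.2) :
    (Measure.pi fun _ => μ).real {x : Fin (m + 2) → EuclideanSpace ℝ (Fin 2) | IsLeftEdge x e} =
      ∫ z, leftMass μ z ^ m ∂(μ.prod μ) := by
  obtain ⟨j, k⟩ := e
  simp only at he
  obtain ⟨k, rfl⟩ := Fin.exists_succAbove_eq he.symm
  have hsec : ∀ p q : EuclideanSpace ℝ (Fin 2), Measure.pi (fun _ : Fin m => μ)
      {y | IsLeftEdge (j.insertNth p (k.insertNth q y : Fin (m + 1) → EuclideanSpace ℝ (Fin 2)) :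
        Fin (m + 2) → EuclideanSpace ℝ (Fin 2)) (j, j.succAbove k)} =
      (μ {r | 0 < orient p q r}) ^ m := by
    intro p q
    have : {y | IsLeftEdge (j.insertNth p (k.insertNth q y : Fin (m + 1) →
        EuclideanSpace ℝ (Fin 2)) : Fin (m + 2) → EuclideanSpace ℝ (Fin 2)) (j, j.succAbove k)} =
        Set.univ.pi fun _ : Fin m => {r | 0 < orient p q r} := by
      ext y
      simp only [IsLeftEdge, Set.mem_ofPred_eq, Set.mem_univ_pi]
      constructor
      · intro h i
        have := h.2 (j.succAbove (k.succAbove i)) (Fin.succAbove_ne _ _)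
          (fun hc => Fin.succAbove_ne k i (Fin.succAbove_right_injective hc))
        simpa using this
      · intro h
        refine ⟨he, fun i hij hik => ?_⟩
        obtain ⟨i, rfl⟩ := Fin.exists_succAbove_eq hij
        obtain ⟨i, rfl⟩ := Fin.exists_succAbove_eq (fun hc : i = k => hik (by rw [hc]))
        simpa using h i
    rw [this, Measure.pi_pi]
    simp
  have hmeas := measurableSet_isLeftEdge (n := m + 2) (j, j.succAbove k)
  have hpi : (Measure.pi fun _ => μ)
      {x : Fin (m + 2) → EuclideanSpace ℝ (Fin 2) | IsLeftEdge x (j, j.succAbove k)} =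
      ∫⁻ z, (μ {r | 0 < orient z.1 z.2 r}) ^ m ∂(μ.prod μ) := by
    rw [lintegral_prod _ (measurable_leftMass_ennreal.pow_const m).aemeasurable,
      pi_apply_insertNth j hmeas]
    refine lintegral_congr fun p => ?_
    have hins : Measurable fun y : Fin (m + 1) → EuclideanSpace ℝ (Fin 2) =>
        (j.insertNth p y : Fin (m + 2) → EuclideanSpace ℝ (Fin 2)) :=
      (MeasurableEquiv.piFinSuccAbove (fun _ => EuclideanSpace ℝ (Fin 2)) j).symm.measurable.comp
        measurable_prodMk_left
    rw [pi_apply_insertNth k (s := {y | (j.insertNth p y : Fin (m + 2) → EuclideanSpace ℝ (Fin 2)) ∈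
      {x | IsLeftEdge x (j, j.succAbove k)}}) (hins hmeas)]
    exact lintegral_congr fun q => hsec p q
  rw [Measure.real, hpi, integral_eq_lintegral_of_nonneg_ae
    (Filter.Eventually.of_forall fun z => pow_nonneg (leftMass_nonneg z) m)
    (measurable_leftMass.pow_const m).aestronglyMeasurable]
  congr 1
  refine lintegral_congr fun z => ?_
  rw [leftMass, Measure.real, ENNReal.ofReal_pow ENNReal.toReal_nonneg,
    ENNReal.ofReal_toReal (measure_ne_top _ _)]

theorem integrable_hullFaceCount_and_integral (hμ : μ ≪ volume) {m : ℕ} (hm : 1 ≤ m) {i : ℕ}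
    (hi : i = 0 ∨ i = 1) :
    Integrable (hullFaceCount i (m + 2)) (Measure.pi fun _ : Fin (m + 2) => μ) ∧
    ∫ x, hullFaceCount i (m + 2) x ∂(Measure.pi fun _ : Fin (m + 2) => μ) =
      (m + 2) * (m + 1) * ∫ z, leftMass μ z ^ m ∂(μ.prod μ) := by
  classical
  have hae : hullFaceCount i (m + 2) =ᵐ[Measure.pi fun _ : Fin (m + 2) => μ]
      fun x => ∑ e : Fin (m + 2) × Fin (m + 2), Set.indicator {x | IsLeftEdge x e} 1 x := by
    filter_upwards [ae_inGeneralPosition hμ (m + 2)] with x hx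
    rw [hx.hullFaceCount_eq (by omega) hi, Set.ncard_eq_toFinset_card']
    simp [Set.indicator_apply]
  have hint : ∀ e ∈ (Finset.univ : Finset (Fin (m + 2) × Fin (m + 2))),
      Integrable (fun x => Set.indicator {x | IsLeftEdge x e} (1 : (Fin (m + 2) → EuclideanSpace ℝ (Fin 2)) → ℝ) x)
        (Measure.pi fun _ : Fin (m + 2) => μ) := fun e _ =>
    (integrable_const (1 : ℝ)).indicator (measurableSet_isLeftEdge e)
  refine ⟨(integrable_finsetSum _ hint).congr hae.symm, ?_⟩
  rw [integral_congr_ae hae, integral_finsetSum _ hint]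
  have hterm : ∀ e : Fin (m + 2) × Fin (m + 2),
      ∫ x, Set.indicator {x | IsLeftEdge x e} (1 : (Fin (m + 2) → EuclideanSpace ℝ (Fin 2)) → ℝ) x ∂(Measure.pi fun _ => μ) =
      if e ∈ (Finset.univ : Finset (Fin (m + 2))).offDiag then
        ∫ z, leftMass μ z ^ m ∂(μ.prod μ) else 0 := by
    intro e
    rw [integral_indicator_one (measurableSet_isLeftEdge e)]
    split_ifs with h
    · exact measureReal_isLeftEdge (by simpa using h)
    · have : {x : Fin (m + 2) → EuclideanSpace ℝ (Fin 2) | IsLeftEdge x e} = ∅ := by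
        ext x
        simp only [Set.mem_ofPred_eq, Set.mem_empty_iff_false, iff_false]
        intro hx
        exact h (by simpa using hx.1)
      rw [this, measureReal_empty]
  rw [Finset.sum_congr rfl fun e _ => hterm e, Finset.sum_ite_mem, Finset.univ_inter,
    Finset.sum_const, Finset.offDiag_card, Finset.card_univ, Fintype.card_fin, nsmul_eq_mul]
  congr 1
  rw [Nat.cast_sub (Nat.le_mul_self _)]
  push_cast
  ring

end planarSampling

/-! ### The one-dimensional inequality for concave profiles -/

/-- `h` is concave on `[p, q]`, positive inside, nonnegative and bounded. -/
structure IsProfile (h : ℝ → ℝ) (p q C : ℝ) : Prop where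
  lt : p < q
  concave : ConcaveOn ℝ (Set.Icc p q) h
  nonneg : ∀ b, 0 ≤ h b
  pos : ∀ b ∈ Set.Ioo p q, 0 < h b
  measurable : Measurable h
  le : ∀ b, h b ≤ C

/-- The signed density comparing the `(m + 1)`-st and `m`-th moments of `1 - v`. -/
noncomputable def momentDensity (m : ℕ) (v : ℝ) : ℝ := (1 - v) ^ m * (2 - (m + 3) * v)

theorem continuous_momentDensity (m : ℕ) : Continuous (momentDensity m) := by
  unfold momentDensity
  fun_prop

namespace IsProfile

variable {h : ℝ → ℝ} {p q C : ℝ}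

theorem reflect (H : IsProfile h p q C) : IsProfile (fun b => h (-b)) (-q) (-p) C where
  lt := neg_lt_neg H.lt
  concave := by
    refine ⟨convex_Icc _ _, fun x hx y hy a b ha hb hab => ?_⟩
    have := H.concave.2 (x := -x) (y := -y) ⟨by linarith [hx.2], by linarith [hx.1]⟩
      ⟨by linarith [hy.2], by linarith [hy.1]⟩ ha hb hab
    convert this using 2
    simp only [smul_eq_mul]
    ring
  nonneg b := H.nonneg _
  pos b hb := H.pos _ ⟨by linarith [hb.2], by linarith [hb.1]⟩
  measurable := H.measurable.comp measurable_neg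
  le b := H.le _

theorem intervalIntegrable_mul (H : IsProfile h p q C) {g : ℝ → ℝ} {a b : ℝ}
    (hg : ContinuousOn g (Set.uIcc a b)) (k : ℕ) :
    IntervalIntegrable (fun t => h t ^ k * g t) volume a b := by
  refine intervalIntegrable_iff.2 ((intervalIntegrable_iff.1 hg.intervalIntegrable).bdd_mul
    (c := C ^ k) (H.measurable.pow_const k).aestronglyMeasurable (Filter.Eventually.of_forall fun t => ?_))
  rw [norm_pow, Real.norm_of_nonneg (H.nonneg t)]
  exact pow_le_pow_left₀ (H.nonneg t) (H.le t) k

theorem intervalIntegrable (H : IsProfile h p q C) (a b : ℝ) :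
    IntervalIntegrable h volume a b := by
  simpa using H.intervalIntegrable_mul (g := fun _ => 1) (a := a) (b := b) continuousOn_const 1

/-- Endpoints are excluded because a chord profile jumps there when the body has an edge of the
given slope. -/
theorem continuousAt (H : IsProfile h p q C) {b : ℝ} (hb : b ∈ Set.Ioo p q) :
    ContinuousAt h b := by
  have hc := (H.concave.subset Set.Ioo_subset_Icc_self (convex_Ioo p q)).continuousOn isOpen_Ioo
  exact hc.continuousAt (isOpen_Ioo.mem_nhds hb)

theorem hasDerivAt_integral (H : IsProfile h p q C) {b : ℝ} (hb : b ∈ Set.Ioo p q) :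
    HasDerivAt (fun b => ∫ t in p..b, h t) (h b) b :=
  intervalIntegral.integral_hasDerivAt_right (H.intervalIntegrable p b)
    H.measurable.stronglyMeasurable.stronglyMeasurableAtFilter (H.continuousAt hb)

theorem continuous_integral (H : IsProfile h p q C) : Continuous fun b => ∫ t in p..b, h t :=
  intervalIntegral.continuous_primitive (fun a b => H.intervalIntegrable a b) p

theorem integral_lt_integral (H : IsProfile h p q C) {a b : ℝ} (hpa : p ≤ a) (hab : a < b)
    (hbq : b ≤ q) : ∫ t in p..a, h t < ∫ t in p..b, h t := by
  rw [← sub_pos, intervalIntegral.integral_interval_sub_left (H.intervalIntegrable _ _)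
    (H.intervalIntegrable _ _)]
  exact intervalIntegral.intervalIntegral_pos_of_pos_on (H.intervalIntegrable _ _)
    (fun t ht => H.pos t ⟨hpa.trans_lt ht.1, ht.2.trans_le hbq⟩) hab

theorem injOn_integral (H : IsProfile h p q C) :
    Set.InjOn (fun b => ∫ t in p..b, h t) (Set.Icc p q) := by
  have : StrictMonoOn (fun b => ∫ t in p..b, h t) (Set.Icc p q) :=
    fun a ha b hb hab => H.integral_lt_integral ha.1 hab hb.2
  exact this.injOn

theorem area_pos (H : IsProfile h p q C) : 0 < ∫ t in p..q, h t := by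
  simpa using H.integral_lt_integral le_rfl H.lt le_rfl

theorem integral_affine (a b c k : ℝ) :
    ∫ t in a..b, (c + k * (t - b)) = c * (b - a) - k * (b - a) ^ 2 / 2 := by
  have hd : ∀ t ∈ Set.uIcc a b,
      HasDerivAt (fun t => c * t + k * (t - b) ^ 2 / 2) (c + k * (t - b)) t := by
    intro t _
    have h1 := ((hasDerivAt_id t).const_mul c).add
      (((((hasDerivAt_id t).sub_const b).pow 2).const_mul k).div_const 2)
    refine h1.congr_deriv ?_
    simp
    ring
  rw [intervalIntegral.integral_eq_sub_of_hasDerivAt hd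
    ((by fun_prop : Continuous fun t => c + k * (t - b)).intervalIntegrable _ _)]
  ring

/-- The quotient of the squared profile by its primitive is antitone. -/
theorem sq_mul_integral_le (H : IsProfile h p q C) {a b : ℝ} (hpa : p < a) (hab : a < b)
    (hbq : b < q) :
    h b ^ 2 * ∫ t in p..a, h t ≤ h a ^ 2 * ∫ t in p..b, h t := by
  have hadd : (∫ t in p..b, h t) = (∫ t in p..a, h t) + ∫ t in a..b, h t :=
    (intervalIntegral.integral_add_adjacent_intervals (H.intervalIntegrable _ _)
      (H.intervalIntegrable _ _)).symm
  have hIa : 0 ≤ ∫ t in p..a, h t :=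
    intervalIntegral.integral_nonneg hpa.le fun t _ => H.nonneg t
  have hIab : 0 ≤ ∫ t in a..b, h t :=
    intervalIntegral.integral_nonneg hab.le fun t _ => H.nonneg t
  rcases le_or_gt (h b) (h a) with hle | hlt
  · have h2 : h b ^ 2 ≤ h a ^ 2 := pow_le_pow_left₀ (H.nonneg b) hle 2
    rw [hadd]
    nlinarith [sq_nonneg (h a)]
  have hba : 0 < b - a := sub_pos.2 hab
  -- Here k > 0 is the slope of the secant over [a, b]. By concavity h lies below this line to the
  -- left of a and above it on [a, b], so both areas compare with those under the line.
  set k := (h b - h a) / (b - a) with hk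
  have hkpos : 0 < k := div_pos (sub_pos.2 hlt) hba
  have hkb : k * (b - a) = h b - h a := by rw [hk]; field_simp
  have hleft : ∫ t in p..a, h t ≤ h a * (a - p) - k * (a - p) ^ 2 / 2 := by
    rw [← integral_affine]
    refine intervalIntegral.integral_mono_on hpa.le (H.intervalIntegrable _ _)
      ((by fun_prop : Continuous fun t => h a + k * (t - a)).intervalIntegrable _ _)
      fun t ht => ?_
    rcases ht.2.eq_or_lt with rfl | hta
    · simp
    have hs := H.concave.slope_anti_adjacent (x := t) (y := a) (z := b)
      ⟨ht.1, (hta.trans (hab.trans hbq)).le⟩ ⟨(hpa.trans hab).le, hbq.le⟩ hta hab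
    rw [← hk, le_div_iff₀ (sub_pos.2 hta)] at hs
    linarith
  have hright : h b * (b - a) - k * (b - a) ^ 2 / 2 ≤ ∫ t in a..b, h t := by
    rw [← integral_affine]
    refine intervalIntegral.integral_mono_on hab.le
      ((by fun_prop : Continuous fun t => h b + k * (t - b)).intervalIntegrable _ _)
      (H.intervalIntegrable _ _) fun t ht => ?_
    have hcc := H.concave.2 (show a ∈ Set.Icc p q from ⟨hpa.le, (hab.trans hbq).le⟩)
      (show b ∈ Set.Icc p q from ⟨(hpa.trans hab).le, hbq.le⟩)
      (show 0 ≤ (b - t) / (b - a) from div_nonneg (by linarith [ht.2]) hba.le)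
      (show 0 ≤ (t - a) / (b - a) from div_nonneg (by linarith [ht.1]) hba.le)
      (by field_simp; ring)
    have e1 : ((b - t) / (b - a)) • a + ((t - a) / (b - a)) • b = t := by
      simp only [smul_eq_mul]; field_simp; ring
    have e2 : ((b - t) / (b - a)) • h a + ((t - a) / (b - a)) • h b = h b + k * (t - b) := by
      simp only [smul_eq_mul, hk]; field_simp; ring
    rwa [e1, e2] at hcc
  -- The upper bound is quadratic in a - p; completing the square removes the dependence on p.
  have h1 : 2 * k * ∫ t in p..a, h t ≤ h a ^ 2 := by
    nlinarith [sq_nonneg (h a - k * (a - p))]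
  have h2 : h b ^ 2 - h a ^ 2 ≤ 2 * k * ∫ t in a..b, h t := by
    have e : 2 * k * (h b * (b - a) - k * (b - a) ^ 2 / 2) = h b ^ 2 - h a ^ 2 := by
      linear_combination (2 * h b - k * (b - a) - (h b - h a)) * hkb
    nlinarith
  have h3 : 0 ≤ h b ^ 2 - h a ^ 2 := by nlinarith [H.nonneg a]
  rw [hadd]
  have h4 : (2 * k * ∫ t in p..a, h t) * (h b ^ 2 - h a ^ 2) ≤
      h a ^ 2 * (2 * k * ∫ t in a..b, h t) :=
    mul_le_mul h1 h2 h3 (sq_nonneg _)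
  have h5 : (∫ t in p..a, h t) * (h b ^ 2 - h a ^ 2) ≤ h a ^ 2 * ∫ t in a..b, h t := by
    have := mul_pos two_pos hkpos
    nlinarith
  linarith

/-- The integrand is the derivative of s² (1 - s/A)^(m+1), where s is the primitive and A the total
integral; this vanishes at both ends. -/
theorem integral_mul_primitive_momentDensity (H : IsProfile h p q C) (m : ℕ) :
    ∫ b in p..q, h b * ((∫ t in p..b, h t) *
      momentDensity m ((∫ t in p..b, h t) / ∫ t in p..q, h t)) = 0 := by
  have hA := H.area_pos
  set A := ∫ t in p..q, h t with hAdef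
  set s : ℝ → ℝ := fun b => ∫ t in p..b, h t with hs
  have hsc : Continuous s := H.continuous_integral
  have hd : ∀ b ∈ Set.Ioo p q, HasDerivAt (fun b => s b ^ 2 * (1 - s b / A) ^ (m + 1))
      (h b * (s b * momentDensity m (s b / A))) b := by
    intro b hb
    have h0 : HasDerivAt s (h b) b := H.hasDerivAt_integral hb
    have h1 := (h0.pow 2).mul (((h0.div_const A).const_sub 1).pow (m + 1))
    refine h1.congr_deriv ?_
    simp [momentDensity, pow_succ]
    field_simp
    ring
  have hint := H.intervalIntegrable_mul (a := p) (b := q)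
    (g := fun b => s b * momentDensity m (s b / A))
    (hsc.mul ((continuous_momentDensity m).comp (hsc.div_const A))).continuousOn 1
  simp only [pow_one] at hint
  rw [intervalIntegral.integral_eq_sub_of_hasDerivAt_of_le H.lt.le
    (((hsc.pow 2).mul ((continuous_const.sub (hsc.div_const A)).pow (m + 1))).continuousOn) hd hint]
  have hsp : s p = 0 := by simp [hs]
  have hsq : s q = A := rfl
  simp [hsp, hsq, hA.ne']

/-- Comparison of the squared profile with a multiple of its primitive. -/
theorem exists_comparison (H : IsProfile h p q C) (m : ℕ) : ∃ c > 0,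
    (∀ b ∈ Set.Ioo p q, 0 ≤ h b * (h b ^ 2 - c * ∫ t in p..b, h t) *
      momentDensity m ((∫ t in p..b, h t) / ∫ t in p..q, h t)) ∧
    (∀ b ∈ Set.Ioo p q, h b * (h b ^ 2 - c * ∫ t in p..b, h t) *
      momentDensity m ((∫ t in p..b, h t) / ∫ t in p..q, h t) = 0 →
      h b ^ 2 = c * (∫ t in p..b, h t) ∨
        ∫ t in p..b, h t = 2 / (m + 3) * ∫ t in p..q, h t) ∧
    ∫ b in p..q, h b * (h b ^ 2 - c * ∫ t in p..b, h t) *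
      momentDensity m ((∫ t in p..b, h t) / ∫ t in p..q, h t) =
    ∫ b in p..q, h b ^ 3 * momentDensity m ((∫ t in p..b, h t) / ∫ t in p..q, h t) := by
  have hA := H.area_pos
  have hzero := H.integral_mul_primitive_momentDensity m
  have hsc := H.continuous_integral
  have hlt : ∀ a b, p ≤ a → a < b → b ≤ q → ∫ t in p..a, h t < ∫ t in p..b, h t :=
    fun a b h1 h2 h3 => H.integral_lt_integral h1 h2 h3
  have hquot : ∀ a b, p < a → a < b → b < q →
      h b ^ 2 * ∫ t in p..a, h t ≤ h a ^ 2 * ∫ t in p..b, h t :=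
    fun a b h1 h2 h3 => H.sq_mul_integral_le h1 h2 h3
  set A := ∫ t in p..q, h t with hAdef
  set s : ℝ → ℝ := fun b => ∫ t in p..b, h t with hs
  have hsp : s p = 0 := by simp [hs]
  have hsq : s q = A := rfl
  change ∀ a b, p ≤ a → a < b → b ≤ q → s a < s b at hlt
  change ∀ a b, p < a → a < b → b < q → h b ^ 2 * s a ≤ h a ^ 2 * s b at hquot
  have hm3 : (0 : ℝ) < m + 3 := by positivity
  have hv0 : 0 < 2 / ((m : ℝ) + 3) * A := by positivity
  have hv1 : 2 / ((m : ℝ) + 3) * A < A := by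
    have : 2 / ((m : ℝ) + 3) < 1 := by
      rw [div_lt_one hm3]
      have : (0 : ℝ) ≤ m := Nat.cast_nonneg m
      linarith
    nlinarith
  -- At x₀ the area fraction equals 2 / (m + 3), the zero of the linear factor of `momentDensity`.
  obtain ⟨x₀, hx₀, hsx₀⟩ : 2 / ((m : ℝ) + 3) * A ∈ s '' Set.Ioo p q := by
    refine intermediate_value_Ioo H.lt.le hsc.continuousOn ⟨?_, ?_⟩
    · rwa [hsp]
    · rwa [hsq]
  have hsx₀pos : 0 < s x₀ := hsx₀ ▸ hv0
  have hslt : ∀ b ∈ Set.Ioo p q, s b < A := fun b hb => hsq ▸ hlt b q hb.1.le hb.2 le_rfl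
  have hone : ∀ b ∈ Set.Ioo p q, 0 < 1 - s b / A := fun b hb => by
    rw [sub_pos, div_lt_one hA]; exact hslt b hb
  have hfac : ∀ b, 2 - ((m : ℝ) + 3) * (s b / A) = (m + 3) / A * (s x₀ - s b) := by
    intro b
    rw [hsx₀]
    field_simp
  -- With c the value of h²/s at x₀, the factors h² - c s and s x₀ - s are both nonnegative before
  -- x₀ and both nonpositive after it.
  refine ⟨h x₀ ^ 2 / s x₀, div_pos (pow_pos (H.pos x₀ hx₀) 2) hsx₀pos, ?_, ?_, ?_⟩
  · intro b hb
    change 0 ≤ h b * (h b ^ 2 - h x₀ ^ 2 / s x₀ * s b) * momentDensity m (s b / A)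
    rw [momentDensity, hfac]
    have hsign : 0 ≤ (h b ^ 2 - h x₀ ^ 2 / s x₀ * s b) * (s x₀ - s b) := by
      rcases lt_trichotomy b x₀ with hbx | rfl | hbx
      · refine mul_nonneg ?_ (sub_nonneg.2 (hlt b x₀ hb.1.le hbx hx₀.2.le).le)
        rw [sub_nonneg, div_mul_eq_mul_div, div_le_iff₀ hsx₀pos]
        exact hquot b x₀ hb.1 hbx hx₀.2
      · simp
      · refine mul_nonneg_of_nonpos_of_nonpos ?_ (sub_nonpos.2 (hlt x₀ b hx₀.1.le hbx hb.2.le).le)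
        rw [sub_nonpos, div_mul_eq_mul_div, le_div_iff₀ hsx₀pos]
        exact hquot x₀ b hx₀.1 hbx hb.2
    have hc : 0 ≤ h b * (1 - s b / A) ^ m * ((m + 3) / A) :=
      mul_nonneg (mul_nonneg (H.nonneg b) (pow_nonneg (hone b hb).le m)) (div_pos hm3 hA).le
    calc 0 ≤ (h b * (1 - s b / A) ^ m * ((m + 3) / A)) *
          ((h b ^ 2 - h x₀ ^ 2 / s x₀ * s b) * (s x₀ - s b)) := mul_nonneg hc hsign
      _ = _ := by ring
  · intro b hb
    change h b * (h b ^ 2 - h x₀ ^ 2 / s x₀ * s b) * momentDensity m (s b / A) = 0 →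
      h b ^ 2 = h x₀ ^ 2 / s x₀ * s b ∨ s b = 2 / (m + 3) * A
    rw [momentDensity, hfac, ← hsx₀]
    intro h0
    have hne : (m + 3) / A ≠ 0 := (div_pos hm3 hA).ne'
    simp only [mul_eq_zero, (H.pos b hb).ne', (pow_pos (hone b hb) m).ne', hne, false_or,
      sub_eq_zero] at h0
    exact h0.imp id Eq.symm
  · change ∫ b in p..q, h b * (h b ^ 2 - h x₀ ^ 2 / s x₀ * s b) * momentDensity m (s b / A) =
      ∫ b in p..q, h b ^ 3 * momentDensity m (s b / A)
    change ∫ b in p..q, h b * (s b * momentDensity m (s b / A)) = 0 at hzero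
    have hDc : Continuous fun b => momentDensity m (s b / A) :=
      (continuous_momentDensity m).comp (hsc.div_const A)
    have hi3 := H.intervalIntegrable_mul (a := p) (b := q) hDc.continuousOn 3
    have hi1 := H.intervalIntegrable_mul (a := p) (b := q) (hsc.mul hDc).continuousOn 1
    simp only [pow_one, Pi.mul_apply] at hi1
    have hsplit : ∀ b, h b * (h b ^ 2 - h x₀ ^ 2 / s x₀ * s b) * momentDensity m (s b / A) =
        h b ^ 3 * momentDensity m (s b / A) -
          h x₀ ^ 2 / s x₀ * (h b * (s b * momentDensity m (s b / A))) := fun b => by ring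
    simp_rw [hsplit]
    rw [intervalIntegral.integral_sub hi3 (hi1.const_mul _), intervalIntegral.integral_const_mul,
      hzero]
    ring

theorem reflect_integral (H : IsProfile h p q C) (b : ℝ) :
    ∫ t in (-q)..(-b), h (-t) = (∫ t in p..q, h t) - ∫ t in p..b, h t := by
  rw [intervalIntegral.integral_comp_neg, neg_neg, neg_neg,
    intervalIntegral.integral_interval_sub_left (H.intervalIntegrable _ _)
    (H.intervalIntegrable _ _)]

/-- The comparison is applied to the profile and to its reflection. Each integrand is nonnegative,
and they vanish together at only finitely many points. -/
theorem integral_cube_mul_momentDensity_pos (H : IsProfile h p q C) (m : ℕ) :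
    0 < ∫ b in p..q, h b ^ 3 *
      (momentDensity m ((∫ t in p..b, h t) / ∫ t in p..q, h t) +
        momentDensity m (1 - (∫ t in p..b, h t) / ∫ t in p..q, h t)) := by
  obtain ⟨c, hc, hnn, hz, heq⟩ := H.exists_comparison m
  obtain ⟨c', hc', hnn', hz', heq'⟩ := H.reflect.exists_comparison m
  have hA := H.area_pos
  have hsc := H.continuous_integral
  have hinj := H.injOn_integral
  have hrefl := H.reflect_integral
  have hreflA : ∫ t in (-q)..(-p), h (-t) = ∫ t in p..q, h t := by simp [hrefl p]
  simp only [hreflA] at hnn' hz' heq'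
  set A := ∫ t in p..q, h t with hAdef
  set s : ℝ → ℝ := fun b => ∫ t in p..b, h t with hs
  change ∀ b, _ = A - s b at hrefl
  have hneg : ∀ b ∈ Set.Ioo p q, -b ∈ Set.Ioo (-q) (-p) :=
    fun b hb => ⟨neg_lt_neg hb.2, neg_lt_neg hb.1⟩
  have hDc : Continuous fun b => momentDensity m (s b / A) :=
    (continuous_momentDensity m).comp (hsc.div_const A)
  have hsc' : Continuous fun b => A - s b := continuous_const.sub hsc
  have hDc' : Continuous fun b => momentDensity m ((A - s b) / A) :=
    (continuous_momentDensity m).comp (hsc'.div_const A)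
  set F : ℝ → ℝ := fun b => h b * (h b ^ 2 - c * s b) * momentDensity m (s b / A) with hF
  set F' : ℝ → ℝ := fun b => h b * (h b ^ 2 - c' * (A - s b)) * momentDensity m ((A - s b) / A)
    with hF'
  have hFnn : ∀ b ∈ Set.Ioo p q, 0 ≤ F b := hnn
  have hF'nn : ∀ b ∈ Set.Ioo p q, 0 ≤ F' b := fun b hb => by
    have := hnn' (-b) (hneg b hb)
    simpa only [hrefl, neg_neg] using this
  have hFi : IntervalIntegrable F volume p q := by
    have := (H.intervalIntegrable_mul (a := p) (b := q) hDc.continuousOn 3).sub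
      (H.intervalIntegrable_mul (a := p) (b := q)
        ((hsc.const_mul c).mul hDc).continuousOn 1)
    refine this.congr fun b _ => ?_
    simp only [hF, Pi.mul_apply]
    ring
  have hF'i : IntervalIntegrable F' volume p q := by
    have := (H.intervalIntegrable_mul (a := p) (b := q) hDc'.continuousOn 3).sub
      (H.intervalIntegrable_mul (a := p) (b := q)
        ((hsc'.const_mul c').mul hDc').continuousOn 1)
    refine this.congr fun b _ => ?_
    simp only [hF', Pi.mul_apply]
    ring
  have heq1 : ∫ b in p..q, F b = ∫ b in p..q, h b ^ 3 * momentDensity m (s b / A) := heq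
  have heq2 : ∫ b in p..q, F' b = ∫ b in p..q, h b ^ 3 * momentDensity m ((A - s b) / A) := by
    rw [← neg_neg p, ← neg_neg q, ← intervalIntegral.integral_comp_neg (fun b => F' b),
      ← intervalIntegral.integral_comp_neg
        (fun b => h b ^ 3 * momentDensity m ((A - s b) / A))]
    have hr : ∀ b, A - s (-b) = ∫ t in (-q)..b, h (-t) := fun b => by
      rw [← hrefl (-b), neg_neg]
    simp only [hF', hr]
    exact heq'
  have hgoal : ∫ b in p..q, h b ^ 3 *
      (momentDensity m (s b / A) + momentDensity m (1 - s b / A)) =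
      ∫ b in p..q, (F b + F' b) := by
    rw [intervalIntegral.integral_add hFi hF'i, heq1, heq2,
      ← intervalIntegral.integral_add (H.intervalIntegrable_mul hDc.continuousOn 3)
        (H.intervalIntegrable_mul hDc'.continuousOn 3)]
    refine intervalIntegral.integral_congr fun b _ => ?_
    have : (A - s b) / A = 1 - s b / A := by field_simp
    simp only [this]
    ring
  change 0 < ∫ b in p..q, h b ^ 3 * (momentDensity m (s b / A) + momentDensity m (1 - s b / A))
  rw [hgoal]
  have hae : 0 ≤ᵐ[volume.restrict (Set.uIoc p q)] fun b => F b + F' b := by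
    rw [Set.uIoc_of_le H.lt.le, ← Measure.restrict_congr_set Ioo_ae_eq_Ioc]
    filter_upwards [ae_restrict_mem measurableSet_Ioo] with b hb using
      add_nonneg (hFnn b hb) (hF'nn b hb)
  rw [intervalIntegral.integral_pos_iff_support_of_nonneg_ae' hae (hFi.add hF'i)]
  refine ⟨H.lt, ?_⟩
  -- If both integrands vanish, s takes one of these values: the first solves c s = c' (A - s), the
  -- other two are the sign changes of the two densities. Strict monotonicity of s leaves finitely
  -- many b.
  set V : Set ℝ := {c' * A / (c + c'), 2 / (m + 3) * A, A - 2 / (m + 3) * A} with hV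
  have hfin : (Set.Icc p q ∩ s ⁻¹' V).Finite := by
    refine Set.Finite.of_finite_image ((Set.toFinite V).subset ?_)
      (hinj.mono Set.inter_subset_left)
    rintro _ ⟨b, hb, rfl⟩
    exact hb.2
  have hsub : Set.Ioo p q \ (Set.Icc p q ∩ s ⁻¹' V) ⊆
      Function.support (fun b => F b + F' b) ∩ Set.Ioc p q := by
    rintro b ⟨hb, hbV⟩
    refine ⟨fun h0 => hbV ⟨Set.Ioo_subset_Icc_self hb, ?_⟩, Set.Ioo_subset_Ioc_self hb⟩
    have hF0 : F b = 0 := by linarith [hFnn b hb, hF'nn b hb]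
    have hF'0 : F' b = 0 := by linarith [hFnn b hb, hF'nn b hb]
    have h1 : h b ^ 2 = c * s b ∨ s b = 2 / (m + 3) * A := hz b hb hF0
    have h2 := hz' (-b) (hneg b hb)
    simp only [hrefl, neg_neg] at h2
    have h2 := h2 hF'0
    simp only [hV, Set.mem_preimage, Set.mem_insert_iff, Set.mem_singleton_iff]
    rcases h1 with h1 | h1
    · rcases h2 with h2 | h2
      · left
        rw [eq_div_iff (by positivity)]
        linarith
      · right; right
        linarith
    · right; left
      exact h1
  refine lt_of_lt_of_le ?_ (measure_mono hsub)
  rw [measure_sdiff_null (hfin.measure_zero volume), Real.volume_Ioo]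
  simpa using H.lt

end IsProfile

/-! ### Chords of a planar convex body in a fixed direction -/

/-- The abscissas of the points of `L` on the line `y = a * x + b`. -/
def chord (L : Set (ℝ × ℝ)) (a b : ℝ) : Set ℝ := {x | (x, a * x + b) ∈ L}

/-- The length of the projection of the chord to the first axis. -/
noncomputable def chordLength (L : Set (ℝ × ℝ)) (a b : ℝ) : ℝ := volume.real (chord L a b)

section chords

variable {L : Set (ℝ × ℝ)}

theorem convex_chord (hL : Convex ℝ L) (a b : ℝ) : Convex ℝ (chord L a b) := by
  intro x hx y hy s t hs ht hst
  have := hL hx hy hs ht hst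
  simp only [chord, Set.mem_ofPred_eq, Prod.smul_mk, Prod.mk_add_mk, smul_eq_mul] at this ⊢
  convert this using 2
  linear_combination (-b) * hst

theorem isCompact_chord (hL : IsCompact L) (a b : ℝ) : IsCompact (chord L a b) := by
  refine (hL.image continuous_fst).of_isClosed_subset
    (hL.isClosed.preimage (f := fun x : ℝ => (x, a * x + b)) (by fun_prop)) ?_
  intro x hx
  exact ⟨_, hx, rfl⟩

theorem exists_chord_eq_Icc (hc : IsCompact L) (hL : Convex ℝ L) {a b : ℝ}
    (h : (chord L a b).Nonempty) : ∃ u v, u ≤ v ∧ chord L a b = Set.Icc u v := by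
  have hconn : IsConnected (chord L a b) := ⟨h, (convex_chord hL a b).isPreconnected⟩
  have heq := eq_Icc_of_connected_compact hconn (isCompact_chord hc a b)
  refine ⟨_, _, ?_, heq⟩
  rw [heq] at h
  exact Set.nonempty_Icc.1 h

theorem exists_chord_nonempty_iff (hc : IsCompact L) (hL : Convex ℝ L) (hne : L.Nonempty) (a : ℝ) :
    ∃ p q, p ≤ q ∧ ∀ b, (chord L a b).Nonempty ↔ b ∈ Set.Icc p q := by
  set T := (fun z : ℝ × ℝ => z.2 - a * z.1) '' L with hT
  have hmem : ∀ b, (chord L a b).Nonempty ↔ b ∈ T := by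
    intro b
    constructor
    · rintro ⟨x, hx⟩
      exact ⟨_, hx, by simp⟩
    · rintro ⟨⟨x, y⟩, hz, rfl⟩
      refine ⟨x, ?_⟩
      change (x, a * x + (y - a * x)) ∈ L
      simpa using hz
  have hcont : Continuous fun z : ℝ × ℝ => z.2 - a * z.1 := by fun_prop
  have hconn : IsConnected T :=
    ⟨hne.image _, hL.isPreconnected.image _ hcont.continuousOn⟩
  have heq := eq_Icc_of_connected_compact hconn (hc.image hcont)
  refine ⟨_, _, ?_, fun b => by rw [hmem, ← heq]⟩
  have := hconn.nonempty
  rw [heq] at this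
  exact Set.nonempty_Icc.1 this

/-- One-dimensional Brunn-Minkowski: convex combinations of the endpoints of two chords lie in the
intermediate chord. -/
theorem concaveOn_chordLength (hc : IsCompact L) (hL : Convex ℝ L) {a p q : ℝ}
    (hpq : ∀ b, (chord L a b).Nonempty ↔ b ∈ Set.Icc p q) :
    ConcaveOn ℝ (Set.Icc p q) (chordLength L a) := by
  refine ⟨convex_Icc p q, fun b₁ hb₁ b₂ hb₂ s t hs ht hst => ?_⟩
  obtain ⟨u₁, v₁, h₁, e₁⟩ := exists_chord_eq_Icc hc hL ((hpq b₁).2 hb₁)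
  obtain ⟨u₂, v₂, h₂, e₂⟩ := exists_chord_eq_Icc hc hL ((hpq b₂).2 hb₂)
  obtain ⟨u, v, h, e⟩ := exists_chord_eq_Icc hc hL
    ((hpq _).2 (convex_Icc p q hb₁ hb₂ hs ht hst))
  have hcomb : ∀ x₁ ∈ chord L a b₁, ∀ x₂ ∈ chord L a b₂,
      s * x₁ + t * x₂ ∈ chord L a (s • b₁ + t • b₂) := by
    intro x₁ hx₁ x₂ hx₂
    have := hL hx₁ hx₂ hs ht hst
    simp only [chord, Set.mem_ofPred_eq, Prod.smul_mk, Prod.mk_add_mk, smul_eq_mul] at this ⊢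
    convert this using 2
    ring
  have hu := hcomb u₁ (e₁ ▸ Set.left_mem_Icc.2 h₁) u₂ (e₂ ▸ Set.left_mem_Icc.2 h₂)
  have hv := hcomb v₁ (e₁ ▸ Set.right_mem_Icc.2 h₁) v₂ (e₂ ▸ Set.right_mem_Icc.2 h₂)
  rw [e] at hu hv
  rw [chordLength, chordLength, chordLength, e₁, e₂, e, smul_eq_mul, smul_eq_mul]
  rw [Real.volume_real_Icc_of_le h, Real.volume_real_Icc_of_le h₁, Real.volume_real_Icc_of_le h₂]
  nlinarith [hu.1, hv.2]

theorem measurable_chord_volume (hc : IsCompact L) :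
    Measurable fun w : ℝ × ℝ => volume (chord L w.1 w.2) := by
  have hcont : Continuous fun w : (ℝ × ℝ) × ℝ => (w.2, w.1.1 * w.2 + w.1.2) := by fun_prop
  exact measurable_measure_prodMk_left (hcont.measurable hc.measurableSet)

theorem measurable_chordLength (hc : IsCompact L) :
    Measurable fun w : ℝ × ℝ => chordLength L w.1 w.2 :=
  (measurable_chord_volume hc).ennreal_toReal

theorem chordLength_nonneg (a b : ℝ) : 0 ≤ chordLength L a b := measureReal_nonneg

theorem exists_chordLength_le (hc : IsCompact L) : ∃ C, ∀ a b, chordLength L a b ≤ C := by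
  have hcomp := hc.image continuous_fst
  refine ⟨volume.real (Prod.fst '' L), fun a b => measureReal_mono ?_ hcomp.measure_ne_top⟩
  intro x hx
  exact ⟨_, hx, rfl⟩

theorem exists_isProfile_chordLength (hc : IsCompact L) (hL : Convex ℝ L)
    (hint : (interior L).Nonempty) : ∃ C, ∀ a, ∃ p q, IsProfile (chordLength L a) p q C ∧
      ∀ b, (chord L a b).Nonempty ↔ b ∈ Set.Icc p q := by
  obtain ⟨C, hC⟩ := exists_chordLength_le hc
  refine ⟨C, fun a => ?_⟩
  obtain ⟨p, q, -, hpq⟩ := exists_chord_nonempty_iff hc hL (hint.mono interior_subset) a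
  have hconc := concaveOn_chordLength hc hL hpq
  obtain ⟨⟨x₀, y₀⟩, h₀⟩ := hint
  set b₀ := y₀ - a * x₀ with hb₀
  have hb₀mem : b₀ ∈ Set.Ioo p q := by
    have hopen : IsOpen {b : ℝ | (x₀, a * x₀ + b) ∈ interior L} :=
      isOpen_interior.preimage (f := fun b : ℝ => (x₀, a * x₀ + b)) (by fun_prop)
    have hsub : {b : ℝ | (x₀, a * x₀ + b) ∈ interior L} ⊆ Set.Icc p q := fun b hb =>
      (hpq b).1 ⟨x₀, interior_subset (s := L) hb⟩
    have := hopen.subset_interior_iff.2 hsub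
    rw [interior_Icc] at this
    refine this ?_
    simpa [hb₀] using h₀
  have hpos₀ : 0 < chordLength L a b₀ := by
    have hopen : IsOpen {x : ℝ | (x, a * x + b₀) ∈ interior L} :=
      isOpen_interior.preimage (f := fun x : ℝ => (x, a * x + b₀)) (by fun_prop)
    have hne : {x : ℝ | (x, a * x + b₀) ∈ interior L}.Nonempty := ⟨x₀, by simpa [hb₀] using h₀⟩
    refine ENNReal.toReal_pos ?_ (isCompact_chord hc a b₀).measure_ne_top
    refine ((hopen.measure_pos volume hne).trans_le (measure_mono fun x hx => ?_)).ne'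
    exact interior_subset (s := L) hx
  refine ⟨p, q, ⟨hb₀mem.1.trans hb₀mem.2, hconc, chordLength_nonneg a, fun b hb => ?_,
    (measurable_chordLength hc).comp measurable_prodMk_left, hC a⟩, hpq⟩
  -- The chord through an interior point has positive length, and concavity spreads this to any b
  -- that gives b₀ positive weight against an endpoint r.
  have key : ∀ r ∈ Set.Icc p q, ∀ θ, 0 < θ → θ ≤ 1 → b = θ * b₀ + (1 - θ) * r →
      0 < chordLength L a b := by
    intro r hr θ hθ hθ1 hb
    have h := hconc.2 (Set.Ioo_subset_Icc_self hb₀mem) hr hθ.le (sub_nonneg.2 hθ1) (by ring)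
    simp only [smul_eq_mul] at h
    rw [← hb] at h
    have h1 := mul_pos hθ hpos₀
    have h2 := mul_nonneg (sub_nonneg.2 hθ1) (chordLength_nonneg (L := L) a r)
    linarith
  have hplt := hb₀mem.1
  have hqlt := hb₀mem.2
  rcases le_total b b₀ with hle | hle
  · have hd : 0 < b₀ - p := sub_pos.2 hplt
    refine key p ⟨le_rfl, (hplt.trans hqlt).le⟩ ((b - p) / (b₀ - p))
      (div_pos (sub_pos.2 hb.1) hd) ((div_le_one hd).2 (by linarith)) ?_
    field_simp
    ring
  · have hd : 0 < q - b₀ := sub_pos.2 hqlt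
    refine key q ⟨(hplt.trans hqlt).le, le_rfl⟩ ((q - b) / (q - b₀))
      (div_pos (sub_pos.2 hb.2) hd) ((div_le_one hd).2 (by linarith)) ?_
    field_simp
    ring

/-- The shear (x, t) ↦ (x, a x + t) preserves area, so Fubini applies along lines of slope a. -/
theorem volume_eq_lintegral_chord {S : Set (ℝ × ℝ)} (hS : MeasurableSet S) (a : ℝ) :
    volume S = ∫⁻ t, volume (chord S a t) := by
  have hS' : MeasurableSet {z : ℝ × ℝ | (z.1, a * z.1 + z.2) ∈ S} :=
    (by fun_prop : Measurable fun z : ℝ × ℝ => (z.1, a * z.1 + z.2)) hS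
  have h1 : volume S = volume {z : ℝ × ℝ | (z.1, a * z.1 + z.2) ∈ S} := by
    rw [Measure.volume_eq_prod, Measure.prod_apply hS, Measure.prod_apply hS']
    refine lintegral_congr fun x => ?_
    exact (measure_preimage_add volume (a * x) (Prod.mk x ⁻¹' S)).symm
  rw [h1, Measure.volume_eq_prod, Measure.prod_apply_symm hS']
  rfl

theorem volume_inter_eq_lintegral (hc : IsCompact L) (a : ℝ) {T : Set ℝ} (hT : MeasurableSet T) :
    volume {z ∈ L | z.2 - a * z.1 ∈ T} = ∫⁻ t in T, volume (chord L a t) := by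
  have hm : MeasurableSet {z ∈ L | z.2 - a * z.1 ∈ T} :=
    hc.measurableSet.inter ((by fun_prop : Measurable fun z : ℝ × ℝ => z.2 - a * z.1) hT)
  rw [volume_eq_lintegral_chord hm a, ← lintegral_indicator hT]
  refine lintegral_congr fun t => ?_
  by_cases ht : t ∈ T
  · rw [Set.indicator_of_mem ht]
    congr 1
    ext x
    simp [chord, ht]
  · rw [Set.indicator_of_notMem ht]
    have : chord {z ∈ L | z.2 - a * z.1 ∈ T} a t = ∅ := by
      ext x
      simp [chord, ht]
    rw [this, measure_empty]

theorem volumeReal_inter_eq_integral (hc : IsCompact L) (a : ℝ) {T : Set ℝ}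
    (hT : MeasurableSet T) :
    volume.real {z ∈ L | z.2 - a * z.1 ∈ T} = ∫ t in T, chordLength L a t := by
  rw [Measure.real, volume_inter_eq_lintegral hc a hT, integral_eq_lintegral_of_nonneg_ae
    (Filter.Eventually.of_forall fun t => chordLength_nonneg a t)
    ((measurable_chordLength hc).comp measurable_prodMk_left).aestronglyMeasurable]
  congr 1
  refine lintegral_congr fun t => ?_
  exact (ENNReal.ofReal_toReal (isCompact_chord hc a t).measure_ne_top).symm

theorem setIntegral_chordLength {a p q : ℝ}
    (hpq : ∀ b, (chord L a b).Nonempty ↔ b ∈ Set.Icc p q) (T : Set ℝ) {u v : ℝ}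
    (huv : u ≤ v) (hT : T ∩ Set.Icc p q = Set.Icc u v) (hTm : MeasurableSet T) :
    ∫ t in T, chordLength L a t = ∫ t in u..v, chordLength L a t := by
  rw [intervalIntegral.integral_of_le huv, ← integral_Icc_eq_integral_Ioc, ← hT]
  refine setIntegral_eq_of_subset_of_forall_sdiff_eq_zero hTm Set.inter_subset_left ?_
  rintro t ⟨ht, htn⟩
  have : ¬ (chord L a t).Nonempty := fun hne => htn ⟨ht, (hpq t).1 hne⟩
  rw [chordLength, Set.not_nonempty_iff_eq_empty.1 this, measureReal_empty]

/-- The area of `L` below a line, on or between the two supporting lines of slope `a`. -/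
theorem volumeReal_below (hc : IsCompact L) {a p q : ℝ}
    (hpq : ∀ b, (chord L a b).Nonempty ↔ b ∈ Set.Icc p q) {b : ℝ} (hb : b ∈ Set.Icc p q) :
    volume.real {z ∈ L | z.2 < a * z.1 + b} = ∫ t in p..b, chordLength L a t := by
  have h1 : volume.real {z ∈ L | z.2 - a * z.1 ∈ Set.Iio b} =
      ∫ t in p..b, chordLength L a t := by
    rw [volumeReal_inter_eq_integral hc a measurableSet_Iio,
      setIntegral_congr_set (Iio_ae_eq_Iic)]
    refine setIntegral_chordLength hpq _ hb.1 ?_ measurableSet_Iic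
    ext t
    simp only [Set.mem_inter_iff, Set.mem_Iic, Set.mem_Icc]
    constructor
    · rintro ⟨h1, h2, -⟩; exact ⟨h2, h1⟩
    · rintro ⟨h1, h2⟩; exact ⟨h2, h1, h2.trans hb.2⟩
  rw [← h1]
  congr 1
  ext z
  simp [sub_lt_iff_lt_add']

theorem volumeReal_above (hc : IsCompact L) {a p q : ℝ}
    (hpq : ∀ b, (chord L a b).Nonempty ↔ b ∈ Set.Icc p q) {b : ℝ} (hb : b ∈ Set.Icc p q) :
    volume.real {z ∈ L | a * z.1 + b < z.2} = ∫ t in b..q, chordLength L a t := by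
  have h1 : volume.real {z ∈ L | z.2 - a * z.1 ∈ Set.Ioi b} =
      ∫ t in b..q, chordLength L a t := by
    rw [volumeReal_inter_eq_integral hc a measurableSet_Ioi,
      setIntegral_congr_set (Ioi_ae_eq_Ici)]
    refine setIntegral_chordLength hpq _ hb.2 ?_ measurableSet_Ici
    ext t
    simp only [Set.mem_inter_iff, Set.mem_Ici, Set.mem_Icc]
    constructor
    · rintro ⟨h1, -, h2⟩; exact ⟨h1, h2⟩
    · rintro ⟨h1, h2⟩; exact ⟨h1, hb.1.trans h1, h2⟩
  rw [← h1]
  congr 1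
  ext z
  simp [lt_sub_iff_add_lt']

theorem volumeReal_eq (hc : IsCompact L) {a p q : ℝ} (h : p ≤ q)
    (hpq : ∀ b, (chord L a b).Nonempty ↔ b ∈ Set.Icc p q) :
    volume.real L = ∫ t in p..q, chordLength L a t := by
  have h1 := volumeReal_inter_eq_integral hc a MeasurableSet.univ
  rw [setIntegral_chordLength hpq _ h (Set.univ_inter _) MeasurableSet.univ] at h1
  simpa using h1

end chords

/-! ### Integration over pairs of points through lines -/

section lines

/-- For fixed abscissas, passing from slope and intercept to the two ordinates is linear with
determinant x₁ - x₂, the source of the weight. -/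
theorem lintegral_line_through {x₁ x₂ : ℝ} (hx : x₁ ≠ x₂) {g : ℝ × ℝ → ENNReal}
    (hg : Measurable g) :
    ∫⁻ y, g y = ENNReal.ofReal |x₁ - x₂| *
      ∫⁻ w : ℝ × ℝ, g (w.1 * x₁ + w.2, w.1 * x₂ + w.2) := by
  set T : ℝ × ℝ →ₗ[ℝ] ℝ × ℝ :=
    Matrix.toLin (Module.Basis.finTwoProd ℝ) (Module.Basis.finTwoProd ℝ) !![x₁, 1; x₂, 1] with hT
  have hTapp : ∀ w : ℝ × ℝ, T w = (w.1 * x₁ + w.2, w.1 * x₂ + w.2) := by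
    intro w
    rw [hT, Matrix.toLin_finTwoProd_apply]
    simp [mul_comm]
  have hdet : LinearMap.det T = x₁ - x₂ := by
    rw [hT, LinearMap.det_toLin, Matrix.det_fin_two_of]
    ring
  have hne : LinearMap.det T ≠ 0 := by rw [hdet]; exact sub_ne_zero.2 hx
  have hTm : Measurable T := T.continuous_of_finiteDimensional.measurable
  have hmap := Measure.map_linearMap_addHaar_eq_smul_addHaar (volume : Measure (ℝ × ℝ)) hne
  have h1 : ∫⁻ w : ℝ × ℝ, g (w.1 * x₁ + w.2, w.1 * x₂ + w.2) =
      ENNReal.ofReal |(x₁ - x₂)⁻¹| * ∫⁻ y, g y := by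
    rw [← hdet, ← smul_eq_mul, ← lintegral_smul_measure, ← hmap, lintegral_map hg hTm]
    simp only [hTapp]
  rw [h1, ← mul_assoc, ← ENNReal.ofReal_mul (abs_nonneg _), ← abs_mul,
    mul_inv_cancel₀ (sub_ne_zero.2 hx)]
  simp

/-- The pair of points with abscissas `w.2.1` and `w.2.2` on the line with slope `w.1.1` and
intercept `w.1.2`. -/
def pointsOnLine (w : (ℝ × ℝ) × (ℝ × ℝ)) : (ℝ × ℝ) × (ℝ × ℝ) :=
  ((w.2.1, w.1.1 * w.2.1 + w.1.2), (w.2.2, w.1.1 * w.2.2 + w.1.2))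

theorem measurable_pointsOnLine : Measurable pointsOnLine := by
  unfold pointsOnLine
  fun_prop

/-- The affine Blaschke-Petkantschin formula for pairs of points in the plane. -/
theorem lintegral_pairs_eq_lintegral_lines {f : (ℝ × ℝ) × (ℝ × ℝ) → ENNReal} (hf : Measurable f) :
    ∫⁻ z, f z = ∫⁻ w : (ℝ × ℝ) × (ℝ × ℝ),
      ENNReal.ofReal |w.2.1 - w.2.2| * f (pointsOnLine w) := by
  have hR : Measurable fun w : (ℝ × ℝ) × (ℝ × ℝ) =>
      ENNReal.ofReal |w.2.1 - w.2.2| * f (pointsOnLine w) := by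
    exact (by fun_prop : Measurable fun w : (ℝ × ℝ) × (ℝ × ℝ) =>
      ENNReal.ofReal |w.2.1 - w.2.2|).mul (hf.comp measurable_pointsOnLine)
  calc ∫⁻ z, f z = ∫⁻ x₁ : ℝ, ∫⁻ y₁ : ℝ, ∫⁻ x₂ : ℝ, ∫⁻ y₂ : ℝ, f ((x₁, y₁), (x₂, y₂)) := by
        rw [Measure.volume_eq_prod, lintegral_prod _ hf.aemeasurable, Measure.volume_eq_prod,
          lintegral_prod _ (hf.lintegral_prod_right').aemeasurable]
        refine lintegral_congr fun x₁ => lintegral_congr fun y₁ => ?_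
        have hg : Measurable fun y : ℝ × ℝ => f ((x₁, y₁), y) := hf.comp measurable_prodMk_left
        rw [lintegral_prod _ hg.aemeasurable]
    _ = ∫⁻ x₁ : ℝ, ∫⁻ x₂ : ℝ, ∫⁻ y₁ : ℝ, ∫⁻ y₂ : ℝ, f ((x₁, y₁), (x₂, y₂)) := by
        refine lintegral_congr fun x₁ => ?_
        refine lintegral_lintegral_swap ?_
        have : Measurable fun w : (ℝ × ℝ) × ℝ => f ((x₁, w.1.1), (w.1.2, w.2)) := by fun_prop
        exact (this.lintegral_prod_right').aemeasurable
    _ = ∫⁻ x₁ : ℝ, ∫⁻ x₂ : ℝ, ENNReal.ofReal |x₁ - x₂| *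
          ∫⁻ l : ℝ × ℝ, f (pointsOnLine (l, (x₁, x₂))) := by
        refine lintegral_congr fun x₁ => ?_
        refine lintegral_congr_ae ?_
        -- Pairs on a vertical line, which have no slope, form a null set.
        filter_upwards [Measure.ae_ne volume x₁] with x₂ hx
        have hg : Measurable fun y : ℝ × ℝ => f ((x₁, y.1), (x₂, y.2)) := by fun_prop
        have := lintegral_line_through (Ne.symm hx) hg
        rw [Measure.volume_eq_prod, lintegral_prod _ hg.aemeasurable] at this
        exact this
    _ = _ := by
        rw [Measure.volume_eq_prod (ℝ × ℝ) (ℝ × ℝ), lintegral_prod_symm _ hR.aemeasurable]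
        have hs : Measurable fun x : ℝ × ℝ => ∫⁻ l : ℝ × ℝ,
            ENNReal.ofReal |x.1 - x.2| * f (pointsOnLine (l, x)) := hR.lintegral_prod_left'
        refine Eq.trans ?_ (lintegral_prod _ hs.aemeasurable).symm
        refine lintegral_congr fun x₁ => lintegral_congr fun x₂ => ?_
        rw [← lintegral_const_mul]
        · exact (hf.comp measurable_pointsOnLine).comp measurable_prodMk_right

/-- Restates the formula as an identity of measures, which carries it over to signed integrands. -/
theorem map_pointsOnLine : Measure.map pointsOnLine
    ((volume : Measure ((ℝ × ℝ) × (ℝ × ℝ))).withDensity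
      fun w => (‖w.2.1 - w.2.2‖₊ : ENNReal)) = volume := by
  refine Measure.ext_of_lintegral _ fun f hf => ?_
  have hfm : Measurable fun w => f (pointsOnLine w) := hf.comp measurable_pointsOnLine
  rw [lintegral_map hf measurable_pointsOnLine, lintegral_withDensity_eq_lintegral_mul _
    (by fun_prop) hfm, lintegral_pairs_eq_lintegral_lines hf]
  refine lintegral_congr fun w => ?_
  simp only [Pi.mul_apply]
  rw [← Real.norm_eq_abs, ofReal_norm]
  rfl

theorem integral_pairs_eq_integral_lines {f : (ℝ × ℝ) × (ℝ × ℝ) → ℝ} (hf : Integrable f) :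
    Integrable (fun w : (ℝ × ℝ) × (ℝ × ℝ) => |w.2.1 - w.2.2| * f (pointsOnLine w)) ∧
    ∫ z, f z = ∫ w : (ℝ × ℝ) × (ℝ × ℝ), |w.2.1 - w.2.2| * f (pointsOnLine w) := by
  have hw : Measurable fun w : (ℝ × ℝ) × (ℝ × ℝ) => ‖w.2.1 - w.2.2‖₊ := by fun_prop
  have hf' := hf
  rw [← map_pointsOnLine] at hf'
  constructor
  · have h1 := (integrable_map_measure hf'.aestronglyMeasurable
      measurable_pointsOnLine.aemeasurable).1 hf'
    rw [integrable_withDensity_iff_integrable_smul hw] at h1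
    exact h1
  · conv_lhs => rw [← map_pointsOnLine]
    rw [integral_map measurable_pointsOnLine.aemeasurable hf'.aestronglyMeasurable,
      integral_withDensity_eq_integral_smul hw]
    rfl

theorem integral_abs_sub {u v x : ℝ} (hx : x ∈ Set.Icc u v) :
    ∫ y in u..v, |x - y| = ((x - u) ^ 2 + (v - x) ^ 2) / 2 := by
  have hi : ∀ a b : ℝ, IntervalIntegrable (fun y => |x - y|) volume a b := fun a b =>
    (by fun_prop : Continuous fun y => |x - y|).intervalIntegrable a b
  rw [← intervalIntegral.integral_add_adjacent_intervals (hi u x) (hi x v)]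
  have h1 : ∫ y in u..x, |x - y| = ∫ y in u..x, (0 + (-1) * (y - x)) := by
    refine intervalIntegral.integral_congr fun y hy => ?_
    rw [Set.uIcc_of_le hx.1] at hy
    rw [abs_of_nonneg (sub_nonneg.2 hy.2)]
    ring
  have h2 : ∫ y in x..v, |x - y| = ∫ y in x..v, (v - x + 1 * (y - v)) := by
    refine intervalIntegral.integral_congr fun y hy => ?_
    rw [Set.uIcc_of_le hx.2] at hy
    rw [abs_of_nonpos (sub_nonpos.2 hy.1)]
    ring
  rw [h1, h2, IsProfile.integral_affine, IsProfile.integral_affine]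
  ring

theorem integral_Icc_prod_abs_sub {u v : ℝ} (huv : u ≤ v) :
    ∫ x in Set.Icc u v ×ˢ Set.Icc u v, |x.1 - x.2| = (v - u) ^ 3 / 3 := by
  rw [Measure.volume_eq_prod, setIntegral_prod]
  · have h1 : ∀ x ∈ Set.Icc u v, ∫ y in Set.Icc u v, |x - y| =
        ((x - u) ^ 2 + (v - x) ^ 2) / 2 := by
      intro x hx
      rw [integral_Icc_eq_integral_Ioc, ← intervalIntegral.integral_of_le huv,
        integral_abs_sub hx]
    rw [setIntegral_congr_fun measurableSet_Icc h1, integral_Icc_eq_integral_Ioc,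
      ← intervalIntegral.integral_of_le huv]
    have hd : ∀ t ∈ Set.uIcc u v,
        HasDerivAt (fun t => ((t - u) ^ 3 - (v - t) ^ 3) / 6) (((t - u) ^ 2 + (v - t) ^ 2) / 2) t := by
      intro t _
      have h1 := ((((hasDerivAt_id t).sub_const u).pow 3).sub
        (((hasDerivAt_id t).const_sub v).pow 3)).div_const 6
      refine h1.congr_deriv ?_
      simp
      ring
    rw [intervalIntegral.integral_eq_sub_of_hasDerivAt hd
      ((by fun_prop : Continuous fun t => ((t - u) ^ 2 + (v - t) ^ 2) / 2).intervalIntegrable _ _)]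
    ring
  · exact (by fun_prop : Continuous fun z : ℝ × ℝ => |z.1 - z.2|).continuousOn.integrableOn_compact
      (isCompact_Icc.prod isCompact_Icc)

theorem integral_chord_prod_abs_sub {L : Set (ℝ × ℝ)} (hc : IsCompact L) (hL : Convex ℝ L)
    (a b : ℝ) :
    ∫ x in chord L a b ×ˢ chord L a b, |x.1 - x.2| = chordLength L a b ^ 3 / 3 := by
  rcases (chord L a b).eq_empty_or_nonempty with he | hne
  · simp [chordLength, he]
  · obtain ⟨u, v, huv, he⟩ := exists_chord_eq_Icc hc hL hne
    rw [chordLength, he, integral_Icc_prod_abs_sub huv, Real.volume_real_Icc_of_le huv]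

end lines

/-! ### Positivity of the moment integral for a convex body -/

/-- The standard coordinates on the Euclidean plane. -/
noncomputable def planePoint : (ℝ × ℝ) ≃L[ℝ] EuclideanSpace ℝ (Fin 2) :=
  ((EuclideanSpace.equiv (Fin 2) ℝ).trans (ContinuousLinearEquiv.finTwoArrow ℝ ℝ)).symm

@[simp]
theorem planePoint_zero (z : ℝ × ℝ) : planePoint z 0 = z.1 := rfl

@[simp]
theorem planePoint_one (z : ℝ × ℝ) : planePoint z 1 = z.2 := rfl

theorem measurePreserving_planePoint : MeasurePreserving planePoint volume volume :=
  (PiLp.volume_preserving_toLp (Fin 2)).comp (volume_preserving_finTwoArrow ℝ).symm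

theorem measurableEmbedding_planePoint : MeasurableEmbedding planePoint :=
  planePoint.toHomeomorph.measurableEmbedding

theorem volumeReal_planePoint_preimage (s : Set (EuclideanSpace ℝ (Fin 2))) :
    volume.real (planePoint ⁻¹' s) = volume.real s := by
  rw [Measure.real, measurePreserving_planePoint.measure_preimage_emb
    measurableEmbedding_planePoint, Measure.real]

theorem orient_planePoint (p q r : ℝ × ℝ) : orient (planePoint p) (planePoint q) (planePoint r) =
    (q.1 - p.1) * (r.2 - p.2) - (q.2 - p.2) * (r.1 - p.1) := by
  simp [orient]

section convexBody

variable {K : Set (EuclideanSpace ℝ (Fin 2))}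

theorem leftMass_planePoint (hK : MeasurableSet K) (p q : ℝ × ℝ) :
    leftMass (cond volume K) (planePoint p, planePoint q) =
      volume.real {z ∈ planePoint ⁻¹' K |
        0 < (q.1 - p.1) * (z.2 - p.2) - (q.2 - p.2) * (z.1 - p.1)} /
      volume.real (planePoint ⁻¹' K) := by
  rw [leftMass, Measure.real, cond_apply hK, ENNReal.toReal_mul, ENNReal.toReal_inv,
    ← Measure.real, ← Measure.real, ← volumeReal_planePoint_preimage,
    ← volumeReal_planePoint_preimage, div_eq_inv_mul]
  simp only [← orient_planePoint]
  rfl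

/-- The pair of points on a line sees the area below and above the line. -/
theorem leftMass_pair (hK : MeasurableSet K) (a b : ℝ) {x₁ x₂ : ℝ} (hx : x₁ < x₂) :
    leftMass (cond volume K) (planePoint (x₁, a * x₁ + b), planePoint (x₂, a * x₂ + b)) =
      volume.real {z ∈ planePoint ⁻¹' K | a * z.1 + b < z.2} / volume.real (planePoint ⁻¹' K) ∧
    leftMass (cond volume K) (planePoint (x₂, a * x₂ + b), planePoint (x₁, a * x₁ + b)) =
      volume.real {z ∈ planePoint ⁻¹' K | z.2 < a * z.1 + b} / volume.real (planePoint ⁻¹' K) := by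
  have hd : 0 < x₂ - x₁ := sub_pos.2 hx
  rw [leftMass_planePoint hK, leftMass_planePoint hK]
  constructor
  · congr 3
    ext z
    have : (x₂ - x₁) * (z.2 - (a * x₁ + b)) - (a * x₂ + b - (a * x₁ + b)) * (z.1 - x₁) =
        (x₂ - x₁) * (z.2 - (a * z.1 + b)) := by ring
    rw [this, mul_pos_iff_of_pos_left hd, sub_pos]
  · congr 3
    ext z
    have : (x₁ - x₂) * (z.2 - (a * x₂ + b)) - (a * x₁ + b - (a * x₂ + b)) * (z.1 - x₂) =
        (x₂ - x₁) * (a * z.1 + b - z.2) := by ring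
    rw [this, mul_pos_iff_of_pos_left hd, sub_pos]

theorem abs_momentDensity_le (m : ℕ) {v : ℝ} (h0 : 0 ≤ v) (h1 : v ≤ 1) :
    |momentDensity m v| ≤ m + 3 := by
  have hm : (0 : ℝ) ≤ m := Nat.cast_nonneg m
  rw [momentDensity, abs_mul, abs_pow, abs_of_nonneg (sub_nonneg.2 h1)]
  have h2 : (1 - v) ^ m ≤ 1 := pow_le_one₀ (sub_nonneg.2 h1) (by linarith)
  have h3 : |2 - (m + 3) * v| ≤ m + 3 := by
    rw [abs_le]
    constructor <;> nlinarith
  calc (1 - v) ^ m * |2 - (m + 3) * v| ≤ 1 * (m + 3) :=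
        mul_le_mul h2 h3 (abs_nonneg _) zero_le_one
    _ = m + 3 := one_mul _

/-- The symmetrized moment density of the mass on the left of a directed line. -/
noncomputable def symmMomentDensity (K : Set (EuclideanSpace ℝ (Fin 2))) (m : ℕ)
    (z : EuclideanSpace ℝ (Fin 2) × EuclideanSpace ℝ (Fin 2)) : ℝ :=
  momentDensity m (1 - leftMass (cond volume K) z) +
    momentDensity m (1 - leftMass (cond volume K) z.swap)

theorem symmMomentDensity_swap (m : ℕ)
    (z : EuclideanSpace ℝ (Fin 2) × EuclideanSpace ℝ (Fin 2)) :
    symmMomentDensity K m z.swap = symmMomentDensity K m z := by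
  rw [symmMomentDensity, symmMomentDensity, Prod.swap_swap, add_comm]

/-- The symmetrized density depends on the line alone: exchanging the points exchanges the areas
above and below. -/
theorem symmMomentDensity_line (hK : IsCompact K) (m : ℕ) {a b p q C : ℝ}
    (hL : IsCompact (planePoint ⁻¹' K)) (H : IsProfile (chordLength (planePoint ⁻¹' K) a) p q C)
    (hpq : ∀ b, (chord (planePoint ⁻¹' K) a b).Nonempty ↔ b ∈ Set.Icc p q)
    (hb : b ∈ Set.Icc p q) {x₁ x₂ : ℝ} (hx : x₁ ≠ x₂) :
    symmMomentDensity K m (planePoint (x₁, a * x₁ + b), planePoint (x₂, a * x₂ + b)) =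
      momentDensity m ((∫ t in p..b, chordLength (planePoint ⁻¹' K) a t) /
        ∫ t in p..q, chordLength (planePoint ⁻¹' K) a t) +
      momentDensity m (1 - (∫ t in p..b, chordLength (planePoint ⁻¹' K) a t) /
        ∫ t in p..q, chordLength (planePoint ⁻¹' K) a t) := by
  wlog hlt : x₁ < x₂ generalizing x₁ x₂
  · rw [← this hx.symm (lt_of_le_of_ne (not_lt.1 hlt) hx.symm)]
    exact (symmMomentDensity_swap m _).symm
  have hA := H.area_pos
  have hab : (∫ t in b..q, chordLength (planePoint ⁻¹' K) a t) =
      (∫ t in p..q, chordLength (planePoint ⁻¹' K) a t) -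
        ∫ t in p..b, chordLength (planePoint ⁻¹' K) a t :=
    (intervalIntegral.integral_interval_sub_left (H.intervalIntegrable _ _)
      (H.intervalIntegrable _ _)).symm
  obtain ⟨h1, h2⟩ := leftMass_pair hK.measurableSet a b hlt
  rw [symmMomentDensity, Prod.swap_prod_mk, h1, h2, volumeReal_above hL hpq hb,
    volumeReal_below hL hpq hb, volumeReal_eq hL H.lt.le hpq, hab, sub_div, div_self hA.ne',
    sub_sub_cancel]

theorem measurable_symmMomentDensity (m : ℕ) [IsProbabilityMeasure (cond volume K)] :
    Measurable (symmMomentDensity K m) := by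
  have h1 : Measurable fun z => momentDensity m (1 - leftMass (cond volume K) z) :=
    (continuous_momentDensity m).measurable.comp (measurable_const.sub measurable_leftMass)
  exact h1.add (h1.comp measurable_swap)

theorem abs_symmMomentDensity_le (m : ℕ) [IsProbabilityMeasure (cond volume K)]
    (z : EuclideanSpace ℝ (Fin 2) × EuclideanSpace ℝ (Fin 2)) :
    |symmMomentDensity K m z| ≤ 2 * (m + 3) := by
  have h : ∀ z, |momentDensity m (1 - leftMass (cond volume K) z)| ≤ m + 3 := fun z =>
    abs_momentDensity_le m (sub_nonneg.2 (leftMass_le_one z))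
      (sub_le_self _ (leftMass_nonneg z))
  refine (abs_add_le _ _).trans ?_
  linarith [h z, h z.swap]

theorem integral_symmMomentDensity_pairs_on_line (hK : IsCompact K) (m : ℕ) {a p q C : ℝ} (b : ℝ)
    (hL : IsCompact (planePoint ⁻¹' K)) (hLc : Convex ℝ (planePoint ⁻¹' K))
    (H : IsProfile (chordLength (planePoint ⁻¹' K) a) p q C)
    (hpq : ∀ b, (chord (planePoint ⁻¹' K) a b).Nonempty ↔ b ∈ Set.Icc p q) :
    ∫ x : ℝ × ℝ, |x.1 - x.2| * ((planePoint ⁻¹' K) ×ˢ (planePoint ⁻¹' K)).indicator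
      (fun z => symmMomentDensity K m (planePoint z.1, planePoint z.2)) (pointsOnLine ((a, b), x)) =
    1 / 3 * (chordLength (planePoint ⁻¹' K) a b ^ 3 *
      (momentDensity m ((∫ t in p..b, chordLength (planePoint ⁻¹' K) a t) /
        ∫ t in p..q, chordLength (planePoint ⁻¹' K) a t) +
      momentDensity m (1 - (∫ t in p..b, chordLength (planePoint ⁻¹' K) a t) /
        ∫ t in p..q, chordLength (planePoint ⁻¹' K) a t))) := by
  set L := planePoint ⁻¹' K with hLdef
  set g := momentDensity m ((∫ t in p..b, chordLength L a t) / ∫ t in p..q, chordLength L a t) +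
      momentDensity m (1 - (∫ t in p..b, chordLength L a t) / ∫ t in p..q, chordLength L a t)
    with hg
  have hpt : ∀ x : ℝ × ℝ, |x.1 - x.2| * (L ×ˢ L).indicator
      (fun z => symmMomentDensity K m (planePoint z.1, planePoint z.2)) (pointsOnLine ((a, b), x)) =
      (chord L a b ×ˢ chord L a b).indicator (fun x => |x.1 - x.2|) x * g := by
    rintro ⟨x₁, x₂⟩
    by_cases hmem : pointsOnLine ((a, b), (x₁, x₂)) ∈ L ×ˢ L
    · have hmem' : (x₁, x₂) ∈ chord L a b ×ˢ chord L a b := hmem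
      rw [Set.indicator_of_mem hmem, Set.indicator_of_mem hmem']
      -- Coincident points do not determine the line, but their weight is zero.
      rcases eq_or_ne x₁ x₂ with rfl | hne
      · simp
      · congr 1
        exact symmMomentDensity_line hK m hL H hpq ((hpq b).1 ⟨x₁, hmem'.1⟩) hne
    · have hmem' : (x₁, x₂) ∉ chord L a b ×ˢ chord L a b := hmem
      rw [Set.indicator_of_notMem hmem, Set.indicator_of_notMem hmem']
      simp
  simp_rw [hpt]
  have hm := (isCompact_chord hL a b).measurableSet
  rw [integral_mul_const, integral_indicator (hm.prod hm), integral_chord_prod_abs_sub hL hLc]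
  ring

/-- The contribution of each slope is already positive, so integrating over slopes only preserves
the sign. -/
theorem setIntegral_symmMomentDensity_pos (hK : IsCompact K) (hconv : Convex ℝ K)
    (hint : (interior K).Nonempty) [IsProbabilityMeasure (cond volume K)] (m : ℕ) :
    0 < ∫ z in K ×ˢ K, symmMomentDensity K m z ∂(volume.prod volume) := by
  have hL : IsCompact (planePoint ⁻¹' K) := planePoint.toHomeomorph.isCompact_preimage.2 hK
  have hLc : Convex ℝ (planePoint ⁻¹' K) :=
    hconv.linear_preimage planePoint.toLinearEquiv.toLinearMap
  have hLint : (interior (planePoint ⁻¹' K)).Nonempty := by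
    refine Set.Nonempty.mono (preimage_interior_subset_interior_preimage planePoint.continuous) ?_
    exact hint.preimage planePoint.surjective
  obtain ⟨C, hC⟩ := exists_isProfile_chordLength hL hLc hLint
  have hprod : MeasurePreserving (Prod.map planePoint planePoint)
      ((volume : Measure (ℝ × ℝ)).prod volume) (volume.prod volume) :=
    measurePreserving_planePoint.prod measurePreserving_planePoint
  have hemb : MeasurableEmbedding (Prod.map planePoint planePoint) :=
    measurableEmbedding_planePoint.prodMap measurableEmbedding_planePoint
  rw [← hprod.setIntegral_preimage_emb hemb]
  change 0 < ∫ z in (planePoint ⁻¹' K) ×ˢ (planePoint ⁻¹' K),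
    symmMomentDensity K m (planePoint z.1, planePoint z.2)
  set L := planePoint ⁻¹' K with hLdef
  have hLL := hL.measurableSet.prod hL.measurableSet
  rw [← integral_indicator hLL]
  set f := (L ×ˢ L).indicator
    (fun z : (ℝ × ℝ) × (ℝ × ℝ) => symmMomentDensity K m (planePoint z.1, planePoint z.2)) with hf
  have hfi : Integrable f := by
    rw [hf, integrable_indicator_iff hLL]
    refine Measure.integrableOn_of_bounded (M := 2 * (m + 3)) (hL.prod hL).measure_ne_top ?_ ?_
    · exact ((measurable_symmMomentDensity m).comp hprod.measurable).aestronglyMeasurable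
    · exact Filter.Eventually.of_forall fun z => abs_symmMomentDensity_le m _
  obtain ⟨hWi, hWeq⟩ := integral_pairs_eq_integral_lines hfi
  have hWi2 : Integrable fun l : ℝ × ℝ =>
      ∫ x : ℝ × ℝ, |x.1 - x.2| * f (pointsOnLine (l, x)) := hWi.integral_prod_left
  have hW2 : ∫ w : (ℝ × ℝ) × (ℝ × ℝ), |w.2.1 - w.2.2| * f (pointsOnLine w) =
      ∫ a : ℝ, ∫ b : ℝ, ∫ x : ℝ × ℝ, |x.1 - x.2| * f (pointsOnLine ((a, b), x)) :=
    (integral_prod _ hWi).trans (integral_prod _ hWi2)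
  rw [hWeq, hW2]
  have hWi3 := hWi2.integral_prod_left
  have hpos : ∀ a : ℝ, 0 < ∫ b : ℝ, ∫ x : ℝ × ℝ, |x.1 - x.2| * f (pointsOnLine ((a, b), x)) := by
    intro a
    obtain ⟨p, q, H, hpq⟩ := hC a
    have hin := fun b => integral_symmMomentDensity_pairs_on_line hK m b hL hLc H hpq
    simp only [← hLdef, ← hf] at hin
    simp_rw [hin]
    rw [integral_const_mul]
    refine mul_pos (by norm_num) ?_
    have hkey := H.integral_cube_mul_momentDensity_pos m
    rw [intervalIntegral.integral_of_le H.lt.le, ← integral_Icc_eq_integral_Ioc,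
      setIntegral_eq_integral_of_forall_compl_eq_zero] at hkey
    · exact hkey
    · intro b hb
      have : ¬ (chord L a b).Nonempty := fun hne => hb ((hpq b).1 hne)
      rw [chordLength, Set.not_nonempty_iff_eq_empty.1 this, measureReal_empty]
      simp
  refine (integral_pos_iff_support_of_nonneg (fun a => (hpos a).le) hWi3).2 ?_
  rw [Function.support_eq_univ fun a => (hpos a).ne']
  simp

/-- Exchanging the two independent points preserves their law, so the symmetrized integral is twice
this one. -/
theorem integral_momentDensity_leftMass_pos (hK : IsCompact K) (hconv : Convex ℝ K)
    (hint : (interior K).Nonempty) [IsProbabilityMeasure (cond volume K)] (m : ℕ) :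
    0 < ∫ z, momentDensity m (1 - leftMass (cond volume K) z)
      ∂((cond volume K).prod (cond volume K)) := by
  set μ := cond volume K with hμ
  have hmeas : Measurable fun z => momentDensity m (1 - leftMass μ z) :=
    (continuous_momentDensity m).measurable.comp (measurable_const.sub measurable_leftMass)
  have hi : Integrable (fun z => momentDensity m (1 - leftMass μ z)) (μ.prod μ) := by
    refine Integrable.of_bound hmeas.aestronglyMeasurable (m + 3)
      (Filter.Eventually.of_forall fun z => ?_)
    exact abs_momentDensity_le m (sub_nonneg.2 (leftMass_le_one z))
      (sub_le_self _ (leftMass_nonneg z))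
  have hswap := integral_prod_swap (μ := μ) (ν := μ) fun z => momentDensity m (1 - leftMass μ z)
  have hsum : ∫ z, symmMomentDensity K m z ∂(μ.prod μ) =
      2 * ∫ z, momentDensity m (1 - leftMass μ z) ∂(μ.prod μ) := by
    unfold symmMomentDensity
    rw [two_mul]
    nth_rw 2 [← hswap]
    exact integral_add hi hi.swap
  have hpos : 0 < ∫ z, symmMomentDensity K m z ∂(μ.prod μ) := by
    rw [hμ, ProbabilityTheory.cond, Measure.prod_smul_left, Measure.prod_smul_right, Measure.prod_restrict,
      integral_smul_measure, integral_smul_measure]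
    have hc : 0 < ((volume K)⁻¹).toReal := by
      refine ENNReal.toReal_pos (ENNReal.inv_ne_zero.2 hK.measure_ne_top) ?_
      exact ENNReal.inv_ne_top.2
        ((isOpen_interior.measure_pos volume hint).trans_le (measure_mono interior_subset)).ne'
    exact mul_pos hc (mul_pos hc (setIntegral_symmMomentDensity_pos hK hconv hint m))
  linarith

theorem momentDensity_one_sub (m : ℕ) (v : ℝ) :
    momentDensity m (1 - v) = (m + 3) * v ^ (m + 1) - (m + 1) * v ^ m := by
  rw [momentDensity]
  ring

theorem integral_momentDensity_leftMass {μ : Measure (EuclideanSpace ℝ (Fin 2))}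
    [IsProbabilityMeasure μ] (m : ℕ) :
    ∫ z, momentDensity m (1 - leftMass μ z) ∂(μ.prod μ) =
      (m + 3) * ∫ z, leftMass μ z ^ (m + 1) ∂(μ.prod μ) -
        (m + 1) * ∫ z, leftMass μ z ^ m ∂(μ.prod μ) := by
  have hi : ∀ k : ℕ, Integrable (fun z => leftMass μ z ^ k) (μ.prod μ) := fun k => by
    refine Integrable.of_bound (measurable_leftMass.pow_const k).aestronglyMeasurable 1
      (Filter.Eventually.of_forall fun z => ?_)
    rw [norm_pow, Real.norm_of_nonneg (leftMass_nonneg z)]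
    exact pow_le_one₀ (leftMass_nonneg z) (leftMass_le_one z)
  simp_rw [momentDensity_one_sub]
  rw [integral_sub ((hi _).const_mul _) ((hi _).const_mul _), integral_const_mul,
    integral_const_mul]

end convexBody

/-! ### One and two points, and the conclusion -/

section smallSamples

variable {μ : Measure (EuclideanSpace ℝ (Fin 2))} [IsProbabilityMeasure μ]

theorem integrable_and_integral_of_ae_eq_const {α : Type*} [MeasurableSpace α] {ν : Measure α}
    [IsProbabilityMeasure ν] {f : α → ℝ} {c : ℝ} (h : ∀ᵐ x ∂ν, f x = c) :
    Integrable f ν ∧ ∫ x, f x ∂ν = c := by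
  refine ⟨(integrable_const c).congr (h.mono fun x hx => hx.symm), ?_⟩
  rw [integral_congr_ae h]
  simp

theorem integrable_hullFaceCount_one (hμ : μ ≪ volume) {i : ℕ} (hi : i = 0 ∨ i = 1) :
    Integrable (hullFaceCount i 1) (Measure.pi fun _ : Fin 1 => μ) ∧
    ∫ x, hullFaceCount i 1 x ∂(Measure.pi fun _ : Fin 1 => μ) = if i = 0 then 1 else 0 :=
  integrable_and_integral_of_ae_eq_const
    ((ae_inGeneralPosition hμ 1).mono fun _ hx => hx.hullFaceCount_one hi)

theorem integrable_hullFaceCount_two (hμ : μ ≪ volume) {i : ℕ} (hi : i = 0 ∨ i = 1) :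
    Integrable (hullFaceCount i 2) (Measure.pi fun _ : Fin 2 => μ) ∧
    ∫ x, hullFaceCount i 2 x ∂(Measure.pi fun _ : Fin 2 => μ) = if i = 0 then 2 else 1 :=
  integrable_and_integral_of_ae_eq_const
    ((ae_inGeneralPosition hμ 2).mono fun _ hx => hx.hullFaceCount_two hi)

end smallSamples

/-- Integrability is part of the conclusion because the integral of a non-integrable function is 0
by convention. -/
theorem theorem1 (K : Set (EuclideanSpace ℝ (Fin 2)))
    (hcompact : IsCompact K) (hconvex : Convex ℝ K) (hint : (interior K).Nonempty)
    (i : ℕ) (hi : i = 0 ∨ i = 1) (n : ℕ) (hn : 1 ≤ n) :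
    Integrable (hullFaceCount i n) (uniformSample K n) ∧
    Integrable (hullFaceCount i (n + 1)) (uniformSample K (n + 1)) ∧
    expectedFaceCount K i n < expectedFaceCount K i (n + 1) := by
  have hK0 : volume K ≠ 0 :=
    ((isOpen_interior.measure_pos volume hint).trans_le (measure_mono interior_subset)).ne'
  have hprob : IsProbabilityMeasure (cond volume K) :=
    cond_isProbabilityMeasure_of_finite hK0 hcompact.measure_ne_top
  have hac : cond volume K ≪ (volume : Measure (EuclideanSpace ℝ (Fin 2))) :=
    cond_absolutelyContinuous
  have hpos := fun m => integral_momentDensity_leftMass_pos hcompact hconvex hint m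
  simp_rw [integral_momentDensity_leftMass] at hpos
  unfold expectedFaceCount uniformSample
  obtain rfl | rfl | ⟨m, hm, rfl⟩ : n = 1 ∨ n = 2 ∨ ∃ m, 1 ≤ m ∧ n = m + 2 := by
    rcases n with _ | _ | _ | n
    · omega
    · exact Or.inl rfl
    · exact Or.inr (Or.inl rfl)
    · exact Or.inr (Or.inr ⟨n + 1, by omega, rfl⟩)
  · obtain ⟨i1, e1⟩ := integrable_hullFaceCount_one hac hi
    obtain ⟨i2, e2⟩ := integrable_hullFaceCount_two hac hi
    refine ⟨i1, i2, ?_⟩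
    rw [e1, e2]
    split_ifs <;> norm_num
  · obtain ⟨i2, e2⟩ := integrable_hullFaceCount_two hac hi
    obtain ⟨i3, e3⟩ := integrable_hullFaceCount_and_integral hac (le_refl 1) hi
    refine ⟨i2, i3, ?_⟩
    -- The case m = 0 reads 3 ∫ G > 1, while the expectation for three points is 6 ∫ G.
    have h0 := hpos 0
    rw [e2, e3]
    simp only [pow_zero, integral_const, probReal_univ, smul_eq_mul] at h0
    norm_num at h0 ⊢
    split_ifs <;> linarith
  · obtain ⟨i1, e1⟩ := integrable_hullFaceCount_and_integral hac hm hi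
    obtain ⟨i2, e2⟩ := integrable_hullFaceCount_and_integral hac (Nat.le_succ_of_le hm) hi
    refine ⟨i1, i2, ?_⟩
    have h0 := hpos m
    rw [e1]
    refine lt_of_lt_of_eq ?_ e2.symm
    push_cast
    have hm0 : (0 : ℝ) < m + 2 := by positivity
    -- The increment is exactly (m + 2) times the positive quantity in `h0`.
    nlinarith [mul_pos hm0 h0]
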